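/- Let $f$ be a polynomial diffeomorphism of $\mathbf C^2$ with non-trivial dynamics. That is, there are a polynomial automorphism $\varphi$ of $\mathbf C^2$ and generalized Hénon maps $f_j(x,y)=(y,\,p_j(y)-a_jx)$, where $p_j$ is a polynomial with $\deg p_j\ge 2$ and $a_j\neq0$ for $1\le j\le m$ and $m\ge1$, such that $\varphi\circ f\circ\varphi^{-1}=f_1\circ\cdots\circ f_m$ (for maps already in this normal form take $\varphi=\mathrm{id}$). Put $d=\prod_j\deg p_j$ and $$G^+(z)=\lim_{n\to\infty}d^{-n}\log^+\|\varphi(f^n z)\| .$$ Let $K^-$ be the set of points with bounded backward orbit, $J^-=\partial K^-$, and let $J^*$ be the closure of the set of periodic points of saddle type. Let $S\subset J^*$ be dense in $J^*$ with $f(S)=S$. For each $x\in S$ let $\psi_x:\mathbf C\to\mathbf C^2$ be an injective holomorphic immersion (so $\psi_x'(\zeta)\ne0$ for all $\zeta$) with $\psi_x(\mathbf C)\subset J^-$. Assume that $f(\psi_x(\mathbf C))=\psi_{f(x)}(\mathbf C)$ for $x\in S$, that for $x_1,x_2\in S$ the sets $\psi_{x_1}(\mathbf C)$ and $\psi_{x_2}(\mathbf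 C)$ are either disjoint or equal, and that $$\psi_x(0)=x,\qquad \max_{|\zeta|\le1}G^+(\psi_x(\zeta))=1\qquad(x\in S).$$ (For example, $S$ may be the set of saddle points and $\psi_x$ the suitably normalized uniformization of the unstable manifold of $x$.) Put $\psi_S=\{\psi_x:x\in S\}$, $m_x(r)=\max_{|\zeta|\le r}G^+(\psi_x(\zeta))$ and $M(r)=\sup_{x\in S}m_x(r)\in[0,\infty]$. Then for each $x\in S$ there is a unique $\lambda_x\in\mathbf C$ such that $f(\psi_x(\zeta))=\psi_{f(x)}(\lambda_x\zeta)$ for all $\zeta\in\mathbf C$, and the following conditions are equivalent: 1. $\psi_S$ is a normal family, i.e. every sequence in $\psi_S$ has a subsequence that converges locally uniformly on $\mathbf C$ or tends to infinity uniformly on compact subsets of $\mathbf C$. 2. $M(r_0)<\infty$ for some $1<r_0<\infty$. 3. For all $0<r_1<r_2<\infty$ there is a constant $k<\infty$ such that, for all $x\in S$, $m_x(r_1)>0$ and $m_x(r_2)/m_x(r_1)\le k$. 4. There exists $\kappa>1$ such that $|\lambda_x|\ge\kappa$ for all $x\in S$. 5. There exist $C,\beta<\infty$ such that $m_x(r)\le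 C r^{\beta}$ for all $x\in S$ and all $r\ge1$. The map $f$ is called quasi-expanding if these conditions hold. -/

import Mathlib

open Filter Topology

noncomputable section

/-- A generalized Hénon map `(x, y) ↦ (y, p(y) - a x)` with `deg p ≥ 2` and `a ≠ 0`. -/
structure GeneralizedHenon where
  p : Polynomial ℂ
  a : ℂ
  two_le_natDegree : 2 ≤ p.natDegree
  a_ne_zero : a ≠ 0

/-- A generalized Hénon map as a bijection of `ℂ²`. -/
def GeneralizedHenon.toPerm (h : GeneralizedHenon) : Equiv.Perm (ℂ × ℂ) where
  toFun z := (z.2, h.p.eval z.2 - h.a * z.1)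
  invFun z := ((h.p.eval z.1 - z.2) / h.a, z.1)
  left_inv z := by
    have ha := h.a_ne_zero
    ext
    · simp [ha]
    · rfl
  right_inv z := by
    have ha := h.a_ne_zero
    ext
    · rfl
    · simp only
      field_simp
      ring

/-- A map `ℂ² → ℂ²` whose two components are polynomials. -/
def IsPolynomialMap (F : ℂ × ℂ → ℂ × ℂ) : Prop :=
  ∃ P Q : MvPolynomial (Fin 2) ℂ, ∀ z : ℂ × ℂ,
    F z = (MvPolynomial.eval ![z.1, z.2] P, MvPolynomial.eval ![z.1, z.2] Q)

/-- Hénon coordinates for a bijection `f` of `ℂ²`: a polynomial automorphism `φ` of `ℂ²` such that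
`φ ∘ f ∘ φ⁻¹ = f₁ ∘ ⋯ ∘ fₘ`, `m ≥ 1`, with generalized Hénon maps `f₁, …, fₘ`. By the theorem of
Friedland and Milnor the polynomial diffeomorphisms with such coordinates are exactly those of
dynamical degree `> 1`. -/
structure HenonCoordinates (f : Equiv.Perm (ℂ × ℂ)) where
  maps : List GeneralizedHenon
  maps_ne_nil : maps ≠ []
  φ : Equiv.Perm (ℂ × ℂ)
  polynomial_φ : IsPolynomialMap φ
  polynomial_φ_symm : IsPolynomialMap φ.symm
  conj : ∀ z, φ (f z) = (maps.map GeneralizedHenon.toPerm).prod (φ z)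

/-- The dynamical degree `d = deg p₁ ⋯ deg pₘ`. -/
def HenonCoordinates.degree {f : Equiv.Perm (ℂ × ℂ)} (H : HenonCoordinates f) : ℕ :=
  (H.maps.map fun h => h.p.natDegree).prod

/-- The Green function `G⁺(z) = lim d⁻ⁿ log⁺ ‖fⁿ z‖`, the norm being taken in Hénon coordinates.
The limit does not depend on the choice of the norm on `ℂ²`. -/
def HenonCoordinates.greenPlus {f : Equiv.Perm (ℂ × ℂ)} (H : HenonCoordinates f)
    (z : ℂ × ℂ) : ℝ :=
  limUnder atTop fun n : ℕ => ((H.degree : ℝ) ^ n)⁻¹ * Real.posLog ‖H.φ ((⇑f)^[n] z)‖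

/-- `K⁻`: the points with bounded backward orbit. -/
def Kminus (f : Equiv.Perm (ℂ × ℂ)) : Set (ℂ × ℂ) :=
  {z | Bornology.IsBounded (Set.range fun n : ℕ => (⇑f.symm)^[n] z)}

/-- `J⁻ = ∂K⁻`. -/
def Jminus (f : Equiv.Perm (ℂ × ℂ)) : Set (ℂ × ℂ) :=
  frontier (Kminus f)

/-- A periodic point of saddle type: for some period `n ≥ 1`, the derivative of `fⁿ` has one
multiplier inside and one multiplier outside the unit circle. -/
def IsSaddlePoint (f : Equiv.Perm (ℂ × ℂ)) (x : ℂ × ℂ) : Prop :=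
  ∃ n : ℕ, 1 ≤ n ∧ (⇑f)^[n] x = x ∧
    ∃ μ ν : ℂ,
      Module.End.HasEigenvalue
        (fderiv ℂ (⇑f)^[n] x : (ℂ × ℂ) →ₗ[ℂ] (ℂ × ℂ)) μ ∧
      Module.End.HasEigenvalue
        (fderiv ℂ (⇑f)^[n] x : (ℂ × ℂ) →ₗ[ℂ] (ℂ × ℂ)) ν ∧
      ‖μ‖ < 1 ∧ 1 < ‖ν‖

/-- `J*`: the closure of the set of saddle points. -/
def Jstar (f : Equiv.Perm (ℂ × ℂ)) : Set (ℂ × ℂ) :=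
  closure {x | IsSaddlePoint f x}

/-- An entire injective immersion `ℂ → ℂ²`. -/
structure IsInjectiveImmersion (ψ : ℂ → ℂ × ℂ) : Prop where
  differentiable : Differentiable ℂ ψ
  injective : Function.Injective ψ
  deriv_ne_zero : ∀ ζ, deriv ψ ζ ≠ 0

/-- `m(r) = max_{|ζ| ≤ r} G (ψ ζ)`. -/
def discMax (G : ℂ × ℂ → ℝ) (ψ : ℂ → ℂ × ℂ) (r : ℝ) : ℝ :=
  sSup ((fun ζ => G (ψ ζ)) '' Metric.closedBall (0 : ℂ) r)

/-- `M(r) = sup_{x ∈ S} m_x(r)`, with values in `[0, ∞]`. -/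
def familySup (G : ℂ × ℂ → ℝ) (S : Set (ℂ × ℂ)) (ψ : ℂ × ℂ → ℂ → ℂ × ℂ) (r : ℝ) : ENNReal :=
  ⨆ x ∈ S, ENNReal.ofReal (discMax G (ψ x) r)

/-- `ψ_S = {ψ_x : x ∈ S}` is an `f`-invariant family of injective immersions into `J⁻`, indexed by
a dense invariant subset `S` of `J*` and normalized by means of `G`. Only the values `ψ x` with
`x ∈ S` matter. -/
structure IsNormalizedFamily (f : Equiv.Perm (ℂ × ℂ)) (G : ℂ × ℂ → ℝ) (S : Set (ℂ × ℂ))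
    (ψ : ℂ × ℂ → ℂ → ℂ × ℂ) : Prop where
  subset_Jstar : S ⊆ Jstar f
  dense : Jstar f ⊆ closure S
  invariant : f '' S = S
  immersion : ∀ x ∈ S, IsInjectiveImmersion (ψ x)
  range_subset : ∀ x ∈ S, Set.range (ψ x) ⊆ Jminus f
  image_range : ∀ x ∈ S, f '' Set.range (ψ x) = Set.range (ψ (f x))
  disjoint_or_eq : ∀ x₁ ∈ S, ∀ x₂ ∈ S,
    (Set.range (ψ x₁) ∩ Set.range (ψ x₂)).Nonempty → Set.range (ψ x₁) = Set.range (ψ x₂)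
  map_zero : ∀ x ∈ S, ψ x 0 = x
  discMax_one : ∀ x ∈ S, discMax G (ψ x) 1 = 1

/-- `l` is the multiplier `λ_x`, i.e. `f (ψ_x ζ) = ψ_{f x} (l ζ)` for all `ζ`. -/
def IsMultiplier (f : Equiv.Perm (ℂ × ℂ)) (ψ : ℂ × ℂ → ℂ → ℂ × ℂ) (x : ℂ × ℂ) (l : ℂ) : Prop :=
  ∀ ζ : ℂ, f (ψ x ζ) = ψ (f x) (l * ζ)

/-- A normal family of entire maps `ℂ → ℂ²`: every sequence in the family has a subsequence that
either converges locally uniformly on `ℂ` or tends to infinity uniformly on compact sets. -/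
def IsNormalFamily (F : Set (ℂ → ℂ × ℂ)) : Prop :=
  ∀ u : ℕ → ℂ → ℂ × ℂ, (∀ n, u n ∈ F) →
    ∃ σ : ℕ → ℕ, StrictMono σ ∧
      ((∃ g : ℂ → ℂ × ℂ, TendstoLocallyUniformly (fun n => u (σ n)) g atTop) ∨
        ∀ K : Set ℂ, IsCompact K → ∀ R : ℝ, ∀ᶠ n in atTop, ∀ ζ ∈ K, R ≤ ‖u (σ n) ζ‖)

end

/-! Multipliers. The curves `f ∘ ψ_x` and `ψ_{f x}` are injective immersions with the same image and
the same base point, so they differ by a bijection of ℂ fixing 0. Its continuity is not automatic,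
because the image may accumulate on itself in ℂ². Its non-analytic points form a closed countable
set; an isolated point of such a set is excluded by Liouville's theorem and injectivity
(`differentiable_of_lift`). An entire bijection with entire inverse that fixes 0 is linear.

Equivalences. On K⁻ the function G⁺ stays within a bounded distance of log⁺‖φ‖
(`exists_greenPlus_sub_posLog_bound`). Hence bounding G⁺ along the curves is the same as bounding
the curves, and J*, where G⁺ = 0 at the saddles, is bounded. The equation G⁺ ∘ f = d G⁺ becomes m_{f
x}(|λ_x| r) = d m_x(r) (`discMax_apply`).

1 ⇒ 2: escape to infinity is impossible since ψ_x(0) = x lies in the bounded set J*. 2 ⇒ 4: m_{f x}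
equals 1 at radius 1 and d ≥ 2 at radius |λ_x|, while the three circles theorem limits uniformly how
fast it can rise, so |λ_x| stays away from 1. 4 ⇒ 5 and 4 ⇒ 3: iterate the functional equation to
bound m_x above at large radii and below at small ones. 5 ⇒ 1 is Montel's theorem, and 3 ⇒ 2 is the
case of radii 1 and 2. -/

/-! ### Reparametrization of injective entire curves -/

/-- An entire map with an entire inverse that fixes the origin is linear. -/
theorem exists_eq_mul_of_differentiable_inverse {H K : ℂ → ℂ} (hH : Differentiable ℂ H)
    (hK : Differentiable ℂ K) (hHK : ∀ z, H (K z) = z) (hKH : ∀ z, K (H z) = z) (h0 : H 0 = 0) :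
    ∃ l : ℂ, ∀ z, H z = l * z := by
  have key : ∀ H K : ℂ → ℂ, Differentiable ℂ H → Differentiable ℂ K → (∀ z, H (K z) = z) →
      (∀ z, K (H z) = z) → H 0 = 0 → Differentiable ℂ fun w => (H w⁻¹)⁻¹ := by
    intro H K hH hK hHK hKH h0
    have hc : Tendsto H (cocompact ℂ) (cocompact ℂ) :=
      (Homeomorph.mk ⟨H, K, hKH, hHK⟩ hH.continuous
        hK.continuous).isClosedEmbedding.tendsto_cocompact
    have hne : ∀ z, z ≠ 0 → H z ≠ 0 := fun z hz h => hz <| by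
      rw [← hKH z, h]; conv_lhs => rw [← h0, hKH]
    rw [← differentiableOn_univ]
    refine (Complex.differentiableOn_compl_singleton_and_continuousAt_iff
      (c := (0 : ℂ)) univ_mem).1 ⟨?_, ?_⟩
    · rintro w ⟨-, hw⟩
      exact (((hH _).comp w (differentiableAt_inv hw)).inv
        (hne _ (inv_ne_zero hw))).differentiableWithinAt
    · rw [continuousAt_iff_punctured_nhds]
      -- The convention `0⁻¹ = 0` already gives the correct value at the removable singularity,
      -- since `H` is proper.
      simp only [inv_zero, h0]
      rw [← Metric.cobounded_eq_cocompact] at hc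
      exact tendsto_inv₀_cobounded.comp (hc.comp tendsto_inv₀_nhdsNE_zero)
  have hK0 : K 0 = 0 := by rw [← h0, hKH, h0]
  have hF := key K H hK hH hKH hHK hK0
  -- Differentiability of `1 / K (1 / w)` at 0 gives `1 / K (1 / w) = O(w)`; the substitution `w = 1
  -- / H z` turns this into `H z = O(z)`.
  have hbig : H =O[cocompact ℂ] fun z => z := by
    have h1 : (fun w => (K w⁻¹)⁻¹) =O[𝓝 0] fun w => w := by
      simpa [hK0] using (hF 0).isBigO_sub
    have hc : Tendsto H (cocompact ℂ) (cocompact ℂ) :=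
      (Homeomorph.mk ⟨H, K, hKH, hHK⟩ hH.continuous
        hK.continuous).isClosedEmbedding.tendsto_cocompact
    rw [← Metric.cobounded_eq_cocompact] at hc ⊢
    have h2 := h1.comp_tendsto (tendsto_inv₀_cobounded.comp hc)
    obtain ⟨C, hC⟩ := h2.bound
    refine Asymptotics.IsBigO.of_bound C ?_
    have hne : ∀ᶠ z : ℂ in Bornology.cobounded ℂ, z ≠ 0 := by
      simpa using Bornology.eventually_ne_cobounded (0 : ℂ)
    filter_upwards [hC, hne] with z hz hz0
    have hHz : H z ≠ 0 := fun h => hz0 <| by rw [← hKH z, h, hK0]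
    simp only [Function.comp, inv_inv, hKH, norm_inv] at hz
    have p1 : 0 < ‖z‖ := norm_pos_iff.2 hz0
    have p2 : 0 < ‖H z‖ := norm_pos_iff.2 hHz
    rw [inv_le_iff_one_le_mul₀ p1] at hz
    have := mul_le_mul_of_nonneg_right hz p2.le
    field_simp at this
    linarith
  obtain ⟨C, hC⟩ := hbig.bound
  rw [← Metric.cobounded_eq_cocompact] at hC
  obtain ⟨R, -, hR⟩ := (hasBasis_cobounded_norm (E := ℂ)).eventually_iff.1 hC
  have hd : ∀ z, ‖deriv H z‖ ≤ 2 * C := by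
    intro z
    -- On the circle of radius `2 * r` about `z` the modulus lies between `r ≥ R` and `3 * r`, so
    -- the linear bound applies and Cauchy's estimate does not depend on `z`.
    set r := ‖z‖ + |R| + 1 with hr
    have hr0 : 0 < r := by positivity
    have hbound : ∀ w ∈ Metric.sphere z (2 * r), ‖H w‖ ≤ C * (3 * r) := by
      intro w hw
      have hw : ‖w - z‖ = 2 * r := by simpa [dist_eq_norm] using hw
      have h1 : ‖w‖ ≤ 3 * r := by
        have := norm_add_le (w - z) z
        rw [sub_add_cancel] at this
        have := abs_nonneg R
        linarith
      have h2 : r ≤ ‖w‖ := by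
        have := norm_sub_le w z
        have := abs_nonneg R
        linarith
      have h3 : R ≤ ‖w‖ := by
        have := le_abs_self R
        have := norm_nonneg z
        linarith
      have h4 : ‖H w‖ ≤ C * ‖w‖ := hR h3
      have hC0 : 0 ≤ C := by
        by_contra hC0
        have := norm_nonneg (H w)
        nlinarith
      exact h4.trans (by gcongr)
    have := Complex.norm_deriv_le_of_forall_mem_sphere_norm_le (by positivity) hH.diffContOnCl
      hbound
    refine this.trans ?_
    have h5 : C * (3 * r) / (2 * r) = 3 / 2 * C := by field_simp
    have hC0 : 0 ≤ C := by
      have := (norm_nonneg _).trans this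
      rw [h5] at this
      linarith
    rw [h5]; linarith
  have hconst : ∀ z, deriv H z = deriv H 0 := fun z =>
    Differentiable.apply_eq_apply_of_bounded (hH.contDiff (n := 2)|>.differentiable_deriv_two)
      ((Metric.isBounded_closedBall (x := (0 : ℂ)) (r := 2 * C)).subset (by
        rintro _ ⟨w, rfl⟩; simpa using hd w)) z 0
  refine ⟨deriv H 0, fun z => ?_⟩
  have hlin : Differentiable ℂ fun z => H z - deriv H 0 * z :=
    hH.sub (differentiable_id.const_mul _)
  have := is_const_of_deriv_eq_zero hlin (fun w => by
    have h := (hH w).hasDerivAt.sub ((hasDerivAt_id w).const_mul (deriv H 0))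
    exact (h.congr_deriv (by simp [hconst w])).deriv) z 0
  simp only [h0, mul_zero, sub_zero] at this
  linear_combination this

/-- Two points of an analytic curve and of an immersed curve that coincide: either the lift of the
first curve to the second one is analytic there, or the graph of the lift is isolated there. -/
theorem analyticAt_or_isolated_of_lift {g h : ℂ → ℂ × ℂ} {H : ℂ → ℂ} (hg : Differentiable ℂ g)
    (hh : Differentiable ℂ h) (hinj : Function.Injective h) (hlift : ∀ z, h (H z) = g z)
    (z₀ : ℂ) (hd : deriv h (H z₀) ≠ 0) :
    AnalyticAt ℂ H z₀ ∨ ∃ U ∈ 𝓝 z₀, ∃ V ∈ 𝓝 (H z₀), ∀ z ∈ U, H z ∈ V → z = z₀ := by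
  obtain ⟨ℓ, hℓ⟩ : ∃ ℓ : ℂ × ℂ →L[ℂ] ℂ, ℓ (deriv h (H z₀)) ≠ 0 := by
    by_contra! hcon
    exact hd (Prod.ext (hcon (ContinuousLinearMap.fst ℂ ℂ ℂ))
      (hcon (ContinuousLinearMap.snd ℂ ℂ ℂ)))
  have han : AnalyticAt ℂ (fun w => ℓ (h w)) (H z₀) :=
    (ℓ.differentiable.comp hh).analyticAt _
  have hder : HasDerivAt (fun w => ℓ (h w)) (ℓ (deriv h (H z₀))) (H z₀) :=
    ℓ.hasFDerivAt.comp_hasDerivAt _ (hh _).hasDerivAt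
  have hℓ' : deriv (fun w => ℓ (h w)) (H z₀) ≠ 0 := by rwa [hder.deriv]
  -- The projection `ℓ ∘ h` is locally invertible, so `q = k ∘ ℓ ∘ g` is the only analytic candidate
  -- for the lift with values near `H z₀`.
  set k := han.hasStrictDerivAt.localInverse _ _ _ hℓ' with hk
  have hkl : ∀ᶠ w in 𝓝 (H z₀), k (ℓ (h w)) = w :=
    han.hasStrictDerivAt.hasStrictFDerivAt_equiv hℓ' |>.eventually_left_inverse
  have hka : AnalyticAt ℂ k (ℓ (h (H z₀))) :=
    han.analyticAt_localInverse hℓ'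
  set q : ℂ → ℂ := fun z => k (ℓ (g z)) with hq
  have hqa : AnalyticAt ℂ q z₀ := by
    refine AnalyticAt.fun_comp (g := k) (f := fun z => ℓ (g z)) ?_
      ((ℓ.differentiable.comp hg).analyticAt _)
    rwa [← hlift z₀]
  have hq0 : q z₀ = H z₀ := by
    simp only [hq, ← hlift]; exact hkl.self_of_nhds
  have hdiff : AnalyticAt ℂ (fun z => g z - h (q z)) z₀ :=
    (hg.analyticAt _).sub ((hh.analyticAt _).fun_comp hqa)
  -- Identity theorem: either `q` is the lift near `z₀`, or `g ≠ h ∘ q` on a punctured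
  -- neighbourhood, where `H z` near `H z₀` would force `q z = H z`.
  rcases hdiff.eventually_eq_zero_or_eventually_ne_zero with h1 | h1
  · left
    refine hqa.congr ?_
    filter_upwards [h1] with z hz
    exact hinj (by rw [hlift, sub_eq_zero.1 hz])
  · right
    obtain ⟨U, hU, hU'⟩ := eventually_nhdsWithin_iff.1 h1 |>.exists_mem
    refine ⟨U, hU, _, hkl, fun z hz hV => ?_⟩
    by_contra hne
    refine hU' z hz hne ?_
    have : q z = H z := by simp only [hq, ← hlift]; exact hV
    rw [this, hlift, sub_self]

/-- Otherwise the set would be perfect and contain a copy of the Cantor space, which is uncountable.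
-/
theorem exists_isolated_of_isClosed_of_countable {E : Set ℂ} (hE : IsClosed E) (hc : E.Countable)
    (hne : E.Nonempty) : ∃ z ∈ E, ∀ᶠ w in 𝓝[≠] z, w ∉ E := by
  by_contra! hcon
  have hp : Perfect E := ⟨hE, fun z hz => by
    rw [accPt_iff_frequently_nhdsNE]
    exact hcon z hz⟩
  obtain ⟨u, hu, -, hui⟩ := hp.exists_nat_bool_injection hne
  have : Countable (Set.range u) := (hc.mono hu).to_subtype
  have : Countable (ℕ → Bool) := (Equiv.ofInjective u hui).injective.countable
  have hle := Cardinal.mk_le_aleph0 (α := ℕ → Bool)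
  rw [← Cardinal.power_def] at hle
  simp only [Cardinal.mk_bool, Cardinal.mk_nat, Cardinal.two_power_aleph0] at hle
  exact Cardinal.aleph0_lt_continuum.not_ge hle

/-- The part of the graph over `E` is a discrete subspace of ℂ², hence countable by the Lindelöf
property. -/
theorem countable_of_isolated_graph {H : ℂ → ℂ} {E : Set ℂ}
    (hE : ∀ z₀ ∈ E, ∃ U ∈ 𝓝 z₀, ∃ V ∈ 𝓝 (H z₀), ∀ z ∈ U, H z ∈ V → z = z₀) : E.Countable := by
  set T : Set (ℂ × ℂ) := (fun z => (z, H z)) '' E with hT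
  have hdisc : DiscreteTopology T := by
    rw [discreteTopology_subtype_iff]
    rintro _ ⟨z₀, hz₀, rfl⟩
    obtain ⟨U, hU, V, hV, hUV⟩ := hE z₀ hz₀
    rw [← disjoint_iff, disjoint_principal_right]
    filter_upwards [mem_nhdsWithin_of_mem_nhds (prod_mem_nhds hU hV), self_mem_nhdsWithin]
    rintro _ ⟨h1, h2⟩ hne ⟨z, -, rfl⟩
    exact hne (by rw [hUV z h1 h2]; rfl)
  have hT' : T.Countable := Set.countable_coe_iff.1 countable_of_Lindelof_of_discrete
  have := hT'.image Prod.fst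
  rwa [hT, Set.image_image, Set.image_id'] at this

/-- The lift of an entire curve to an immersed entire curve with the same image is entire. -/
theorem differentiable_of_lift {g h : ℂ → ℂ × ℂ} {H : ℂ → ℂ} (hg : Differentiable ℂ g)
    (hh : Differentiable ℂ h) (hinj : Function.Injective h) (hd : ∀ z, deriv h z ≠ 0)
    (hlift : ∀ z, h (H z) = g z) : Differentiable ℂ H := by
  set E : Set ℂ := {z | ¬ AnalyticAt ℂ H z} with hE
  have hiso : ∀ z₀ ∈ E, ∃ U ∈ 𝓝 z₀, ∃ V ∈ 𝓝 (H z₀), ∀ z ∈ U, H z ∈ V → z = z₀ := fun z₀ hz₀ =>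
    (analyticAt_or_isolated_of_lift hg hh hinj hlift z₀ (hd _)).resolve_left hz₀
  have hcl : IsClosed E := (isOpen_analyticAt ℂ H).isClosed_compl
  by_contra hcon
  have hne : E.Nonempty := by
    by_contra hemp
    refine hcon fun z => ?_
    by_contra hz
    exact hemp ⟨z, fun ha => hz ha.differentiableAt⟩
  obtain ⟨z₀, hz₀, hz₀'⟩ :=
    exists_isolated_of_isClosed_of_countable hcl (countable_of_isolated_graph hiso) hne
  obtain ⟨U, hU, V, hV, hUV⟩ := hiso z₀ hz₀
  obtain ⟨ε, hε, hεV⟩ := Metric.mem_nhds_iff.1 hV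
  have hfar : ∀ᶠ z in 𝓝[≠] z₀, ε ≤ ‖H z - H z₀‖ := by
    filter_upwards [mem_nhdsWithin_of_mem_nhds hU, self_mem_nhdsWithin] with z hz hne
    by_contra! hlt
    exact hne (hUV z hz (hεV (by simpa [dist_eq_norm] using hlt)))
  have hana : ∀ᶠ z in 𝓝[≠] z₀, AnalyticAt ℂ H z := hz₀'.mono fun z hz => not_not.1 hz
  -- Near the isolated bad point `H` keeps a distance `ε` from `H z₀`, so `q` is bounded and its
  -- singularity is removable.
  set q : ℂ → ℂ := fun z => (H z - H z₀)⁻¹ with hq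
  obtain ⟨Q, hQa, hQq⟩ : ∃ Q : ℂ → ℂ, AnalyticAt ℂ Q z₀ ∧ ∀ᶠ z in 𝓝[≠] z₀, Q z = q z := by
    set Q := Function.update q z₀ (limUnder (𝓝[≠] z₀) q) with hQ
    have hev : ∀ᶠ z in 𝓝[≠] z₀, ε ≤ ‖H z - H z₀‖ ∧ AnalyticAt ℂ H z := hfar.and hana
    obtain ⟨s, hs, hs'⟩ := (eventually_nhdsWithin_iff.1 hev).exists_mem
    have hdiff : DifferentiableOn ℂ q (s \ {z₀}) := by
      rintro z ⟨hz, hzn⟩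
      obtain ⟨h1, h2⟩ := hs' z hz hzn
      refine ((h2.differentiableAt.sub_const _).inv ?_).differentiableWithinAt
      exact norm_pos_iff.1 (hε.trans_le h1)
    have hbdd : BddAbove (norm ∘ q '' (s \ {z₀})) := by
      refine ⟨ε⁻¹, ?_⟩
      rintro _ ⟨z, ⟨hz, hzn⟩, rfl⟩
      obtain ⟨h1, h2⟩ := hs' z hz hzn
      simp only [hq, Function.comp, norm_inv]
      exact inv_anti₀ hε h1
    refine ⟨Q, ?_, ?_⟩
    · exact (Complex.differentiableOn_update_limUnder_of_bddAbove hs hdiff hbdd).analyticAt hs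
    · filter_upwards [self_mem_nhdsWithin] with z hz
      exact Function.update_of_ne hz _ _
  have hQt : Tendsto Q (𝓝[≠] z₀) (𝓝 (Q z₀)) := hQa.continuousAt.continuousWithinAt
  have hHq : ∀ᶠ z in 𝓝[≠] z₀, H z = H z₀ + (Q z)⁻¹ := hQq.mono fun z hz => by
    rw [hz, hq]; simp
  have hgt : Tendsto g (𝓝[≠] z₀) (𝓝 (g z₀)) := hg.continuous.continuousAt.continuousWithinAt
  -- If `Q z₀ = 0`, then `H` has a pole; openness of `Q` makes every large `w` a value of `H` near
  -- `z₀`, so `h` is bounded near infinity and constant. Otherwise `H` has a limit different from `H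
  -- z₀` at which `h` takes the same value.
  by_cases hQ0 : Q z₀ = 0
  · have hQne : ∀ᶠ z in 𝓝[≠] z₀, Q z ≠ 0 := by
      filter_upwards [hQq, hfar] with z h1 h2
      rw [h1]
      exact inv_ne_zero (norm_pos_iff.1 (hε.trans_le h2))
    have hopen : 𝓝 (Q z₀) ≤ map Q (𝓝 z₀) := by
      refine hQa.eventually_constant_or_nhds_le_map_nhds.resolve_left fun hc => ?_
      obtain ⟨z, h1, h2⟩ := ((hc.filter_mono nhdsWithin_le_nhds).and hQne).exists
      exact h2 (h1.trans hQ0)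
    have hgb : ∀ᶠ z in 𝓝 z₀, ‖g z‖ < ‖g z₀‖ + 1 :=
      hg.continuous.norm.continuousAt.eventually_lt_const (by simp)
    have hcob : ∀ᶠ w in Bornology.cobounded ℂ, ‖h w‖ ≤ ‖g z₀‖ + 1 := by
      have hgood : ∀ᶠ z in 𝓝 z₀, z ≠ z₀ → H z = H z₀ + (Q z)⁻¹ ∧ ‖g z‖ < ‖g z₀‖ + 1 := by
        filter_upwards [eventually_nhdsWithin_iff.1 hHq, hgb] with z h1 h2 h3
        exact ⟨h1 h3, h2⟩
      have himg := hopen (image_mem_map hgood)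
      rw [hQ0] at himg
      have ht : Tendsto (fun w : ℂ => (w - H z₀)⁻¹) (Bornology.cobounded ℂ) (𝓝 0) :=
        tendsto_inv₀_cobounded.comp (by simp)
      filter_upwards [ht himg, Bornology.eventually_ne_cobounded (H z₀)] with w ⟨z, hz, hzw⟩ hw
      have hzne : z ≠ z₀ := by
        rintro rfl
        rw [hQ0] at hzw
        exact inv_ne_zero (sub_ne_zero.2 hw) hzw.symm
      obtain ⟨h1, h2⟩ := hz hzne
      rw [hzw, inv_inv, add_sub_cancel] at h1
      rw [← h1, hlift]; exact h2.le
    obtain ⟨R, -, hR⟩ := (hasBasis_cobounded_norm (E := ℂ)).eventually_iff.1 hcob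
    obtain ⟨B, hB⟩ := (isCompact_closedBall (0 : ℂ) R).exists_bound_of_continuousOn
      hh.continuous.continuousOn
    have hbd : Bornology.IsBounded (Set.range h) := by
      refine (Metric.isBounded_closedBall (x := (0 : ℂ × ℂ)) (r := max B (‖g z₀‖ + 1))).subset ?_
      rintro _ ⟨w, rfl⟩
      rw [mem_closedBall_zero_iff]
      rcases le_total R ‖w‖ with hw | hw
      · exact (hR hw).trans (le_max_right _ _)
      · exact (hB w (by simpa using hw)).trans (le_max_left _ _)
    exact zero_ne_one (hinj (hh.apply_eq_apply_of_bounded hbd 0 1))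
  · have hHt : Tendsto H (𝓝[≠] z₀) (𝓝 (H z₀ + (Q z₀)⁻¹)) :=
      ((tendsto_const_nhds).add (hQt.inv₀ hQ0)).congr' (hHq.mono fun z hz => hz.symm)
    have h1 : Tendsto (fun z => h (H z)) (𝓝[≠] z₀) (𝓝 (h (H z₀ + (Q z₀)⁻¹))) :=
      (hh.continuous.tendsto _).comp hHt
    simp only [hlift] at h1
    have h2 := tendsto_nhds_unique h1 hgt
    rw [← hlift z₀] at h2
    exact inv_ne_zero hQ0 (by simpa using hinj h2)

/-- Two injective entire immersions with the same image and the same base point differ by a linear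
change of parameter. -/
theorem existsUnique_eq_comp_mul {g h : ℂ → ℂ × ℂ} (hg : IsInjectiveImmersion g)
    (hh : IsInjectiveImmersion h) (hrange : Set.range g = Set.range h) (h0 : g 0 = h 0) :
    ∃! l : ℂ, ∀ ζ, g ζ = h (l * ζ) := by
  have hex : ∀ z, ∃ w, h w = g z := fun z =>
    hrange.subset (Set.mem_range_self z)
  have hex' : ∀ z, ∃ w, g w = h z := fun z =>
    hrange.symm.subset (Set.mem_range_self z)
  choose H hH using hex
  choose K hK using hex'
  obtain ⟨l, hl⟩ := exists_eq_mul_of_differentiable_inverse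
    (differentiable_of_lift hg.differentiable hh.differentiable hh.injective hh.deriv_ne_zero hH)
    (differentiable_of_lift hh.differentiable hg.differentiable hg.injective hg.deriv_ne_zero hK)
    (fun z => hh.injective (by rw [hH, hK])) (fun z => hg.injective (by rw [hK, hH]))
    (hh.injective (by rw [hH, h0]))
  refine ⟨l, fun ζ => by rw [← hl, hH], fun l' hl' => ?_⟩
  have := hl' 1
  rw [← hH, hl] at this
  simpa using (hh.injective this).symm

/-! ### Filtration and growth for compositions of Hénon maps -/

theorem Polynomial.exists_norm_eval_le (p : Polynomial ℂ) :
    ∃ B : ℝ, 0 ≤ B ∧ ∀ z, ‖p.eval z‖ ≤ B * max 1 ‖z‖ ^ p.natDegree := by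
  refine ⟨∑ i ∈ Finset.range (p.natDegree + 1), ‖p.coeff i‖, by positivity, fun z => ?_⟩
  rw [Polynomial.eval_eq_sum_range, Finset.sum_mul]
  refine norm_sum_le_of_le _ fun i hi => ?_
  rw [norm_mul, norm_pow]
  refine mul_le_mul_of_nonneg_left ?_ (norm_nonneg _)
  calc ‖z‖ ^ i ≤ max 1 ‖z‖ ^ i := by gcongr; exact le_max_right _ _
    _ ≤ max 1 ‖z‖ ^ p.natDegree :=
      pow_le_pow_right₀ (le_max_left _ _) (Nat.lt_succ_iff.1 (Finset.mem_range.1 hi))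

/-- Write `p(z)` as `z ^ natDegree` times the reversed polynomial at `z⁻¹`, which tends to the
leading coefficient. -/
theorem Polynomial.exists_le_norm_eval {p : Polynomial ℂ} (hp : p ≠ 0) :
    ∃ c : ℝ, 0 < c ∧ ∀ᶠ R : ℝ in atTop, ∀ z, R < ‖z‖ → c * ‖z‖ ^ p.natDegree ≤ ‖p.eval z‖ := by
  have hl : 0 < ‖p.leadingCoeff‖ := norm_pos_iff.2 (Polynomial.leadingCoeff_ne_zero.2 hp)
  refine ⟨‖p.leadingCoeff‖ / 2, by positivity, ?_⟩
  have h0 : ‖p.reverse.eval 0‖ = ‖p.leadingCoeff‖ := by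
    rw [← Polynomial.coeff_zero_eq_eval_zero, Polynomial.coeff_zero_reverse]
  have ht : Tendsto (fun z : ℂ => ‖p.reverse.eval z⁻¹‖) (Bornology.cobounded ℂ)
      (𝓝 ‖p.leadingCoeff‖) := by
    rw [← h0]
    exact (p.reverse.continuous.norm.tendsto 0).comp tendsto_inv₀_cobounded
  obtain ⟨R₀, -, hR₀⟩ := (hasBasis_cobounded_norm (E := ℂ)).eventually_iff.1
    (ht.eventually_const_le (half_lt_self hl))
  filter_upwards [eventually_ge_atTop R₀, eventually_ge_atTop 0] with R hR hR' z hz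
  have hz0 : z ≠ 0 := norm_pos_iff.1 (hR'.trans_lt hz)
  have := invertibleOfNonzero hz0
  have heq := Polynomial.eval₂_reverse_mul_pow (RingHom.id ℂ) z p
  rw [invOf_eq_inv] at heq
  simp only [Polynomial.eval₂_id] at heq
  rw [← heq, norm_mul, norm_pow]
  exact mul_le_mul_of_nonneg_right (hR₀ (hR.trans hz.le)) (by positivity)

/-- The complement of the region `‖x‖ > max R ‖y‖`, which is absorbing for the inverses of
generalized Hénon maps. -/
def forwardRegion (R : ℝ) : Set (ℂ × ℂ) := {w | ‖w.1‖ ≤ max R ‖w.2‖}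

/-- The behaviour of compositions of generalized Hénon maps, with total degree `D`, relative to
`forwardRegion R`. -/
structure IsFiltered (R : ℝ) (F : Equiv.Perm (ℂ × ℂ)) (D : ℕ) : Prop where
  two_le : 2 ≤ D
  expands : ∀ w, w ∉ forwardRegion R →
    F.symm w ∉ forwardRegion R ∧ 2 * ‖w.1‖ ≤ ‖(F.symm w).1‖
  growth : ∃ C : ℝ, ∀ w ∈ forwardRegion R,
    |Real.posLog ‖F w‖ - D * Real.posLog ‖w‖| ≤ C
  max_le : ∀ w ∈ forwardRegion R, max R ‖w‖ ≤ max R ‖F w‖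

theorem IsFiltered.mapsTo {R : ℝ} {F : Equiv.Perm (ℂ × ℂ)} {D : ℕ} (hF : IsFiltered R F D)
    {w : ℂ × ℂ} (hw : w ∈ forwardRegion R) : F w ∈ forwardRegion R := by
  by_contra hcon
  have := (hF.expands _ hcon).1
  rw [Equiv.symm_apply_apply] at this
  exact this hw

theorem IsFiltered.mul {R : ℝ} {F₁ F₂ : Equiv.Perm (ℂ × ℂ)} {D₁ D₂ : ℕ}
    (h₁ : IsFiltered R F₁ D₁) (h₂ : IsFiltered R F₂ D₂) : IsFiltered R (F₁ * F₂) (D₁ * D₂) where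
  two_le := by nlinarith [h₁.two_le, h₂.two_le]
  expands w hw := by
    obtain ⟨a, b⟩ := h₁.expands w hw
    obtain ⟨c, d⟩ := h₂.expands _ a
    refine ⟨c, ?_⟩
    change _ ≤ ‖(F₂.symm (F₁.symm w)).1‖
    linarith [norm_nonneg w.1]
  growth := by
    obtain ⟨C₁, hC₁⟩ := h₁.growth
    obtain ⟨C₂, hC₂⟩ := h₂.growth
    refine ⟨C₁ + D₁ * C₂, fun w hw => ?_⟩
    have a := hC₁ _ (h₂.mapsTo hw)
    have b := hC₂ _ hw
    rw [Equiv.Perm.mul_apply]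
    have heq : Real.posLog ‖F₁ (F₂ w)‖ - (D₁ * D₂ : ℕ) * Real.posLog ‖w‖ =
        (Real.posLog ‖F₁ (F₂ w)‖ - D₁ * Real.posLog ‖F₂ w‖) +
          D₁ * (Real.posLog ‖F₂ w‖ - D₂ * Real.posLog ‖w‖) := by
      push_cast; ring
    rw [heq]
    refine (abs_add_le _ _).trans (add_le_add a ?_)
    rw [abs_mul, Nat.abs_cast]
    gcongr
  max_le w hw := (h₂.max_le w hw).trans (h₁.max_le _ (h₂.mapsTo hw))

theorem GeneralizedHenon.eventually_isFiltered (h : GeneralizedHenon) :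
    ∀ᶠ R : ℝ in atTop, IsFiltered R h.toPerm h.p.natDegree := by
  set d := h.p.natDegree with hd
  have hd2 : 2 ≤ d := h.two_le_natDegree
  have hp0 : h.p ≠ 0 := by
    intro h0
    rw [hd, h0] at hd2
    simp at hd2
  have ha : 0 < ‖h.a‖ := norm_pos_iff.2 h.a_ne_zero
  obtain ⟨B, hB0, hB⟩ := h.p.exists_norm_eval_le
  obtain ⟨c, hc, hcR⟩ := Polynomial.exists_le_norm_eval hp0
  filter_upwards [hcR, eventually_ge_atTop 1, eventually_ge_atTop ((2 * ‖h.a‖ + 1) / c)]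
    with R hlow hR1 hRc
  rw [div_le_iff₀ hc] at hRc
  -- The factor `2 * ‖h.a‖ + 1` serves twice: it absorbs `‖w.2‖` in the backward doubling, and it
  -- makes `‖h.a‖ * ‖z‖` at most half of the leading term in the forward bound.
  have hlow' : ∀ z : ℂ, R < ‖z‖ → (2 * ‖h.a‖ + 1) * ‖z‖ ≤ c * ‖z‖ ^ d := by
    intro z hz
    have h1 : ‖z‖ * ‖z‖ ≤ ‖z‖ ^ d := by
      rw [← sq]; exact pow_le_pow_right₀ (hR1.trans hz.le) hd2
    calc (2 * ‖h.a‖ + 1) * ‖z‖ ≤ (R * c) * ‖z‖ := by gcongr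
      _ ≤ (‖z‖ * c) * ‖z‖ := by gcongr
      _ = c * (‖z‖ * ‖z‖) := by ring
      _ ≤ c * ‖z‖ ^ d := by gcongr
  refine ⟨hd2, fun w hw => ?_, ?_, fun w hw => ?_⟩
  · simp only [forwardRegion, Set.mem_ofPred_eq, not_le, max_lt_iff] at hw ⊢
    change (R < ‖(h.p.eval w.1 - w.2) / h.a‖ ∧ ‖w.1‖ < ‖(h.p.eval w.1 - w.2) / h.a‖) ∧
      2 * ‖w.1‖ ≤ ‖(h.p.eval w.1 - w.2) / h.a‖
    have key : 2 * ‖w.1‖ ≤ ‖(h.p.eval w.1 - w.2) / h.a‖ := by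
      rw [norm_div, le_div_iff₀ ha]
      have h1 := norm_sub_norm_le (h.p.eval w.1) w.2
      have h2 := hlow _ hw.1
      have h3 := hlow' _ hw.1
      linarith [hw.2]
    refine ⟨⟨?_, ?_⟩, key⟩ <;> linarith [hw.1]
  · have hB' : (1 : ℝ) ≤ B + ‖h.a‖ + 1 := by linarith
    -- The three entries are the upper bound, the lower bound for `‖w.2‖ ≤ R`, where `w` is bounded,
    -- and the lower bound for `‖w.2‖ > R`.
    refine ⟨max (Real.log (B + ‖h.a‖ + 1)) (max (d * Real.log R) (-Real.log (c / 2))),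
      fun w hw => ?_⟩
    have hval : ‖h.toPerm w‖ = max ‖w.2‖ ‖h.p.eval w.2 - h.a * w.1‖ := rfl
    have hw1 : ‖w.1‖ ≤ ‖w‖ := norm_fst_le w
    have hw2 : ‖w.2‖ ≤ ‖w‖ := norm_snd_le w
    have hm : 1 ≤ max 1 ‖w‖ := le_max_left _ _
    have hmd : max 1 ‖w‖ ≤ max 1 ‖w‖ ^ d := le_self_pow₀ hm (by omega)
    rw [abs_sub_le_iff]
    constructor
    · refine le_trans ?_ (le_max_left _ _)
      have hup : max 1 ‖h.toPerm w‖ ≤ (B + ‖h.a‖ + 1) * max 1 ‖w‖ ^ d := by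
        have hone : 1 ≤ max 1 ‖w‖ ^ d := hm.trans hmd
        rw [hval]
        refine max_le ?_ (max_le ?_ ?_)
        · nlinarith
        · have : ‖w.2‖ ≤ max 1 ‖w‖ := hw2.trans (le_max_right _ _)
          nlinarith
        · have e1 : ‖h.p.eval w.2‖ ≤ B * max 1 ‖w‖ ^ d := (hB w.2).trans (by gcongr)
          have e2 : ‖h.a * w.1‖ ≤ ‖h.a‖ * max 1 ‖w‖ ^ d := by
            rw [norm_mul]
            have := (hw1.trans (le_max_right 1 _)).trans hmd
            gcongr
          have := norm_sub_le (h.p.eval w.2) (h.a * w.1)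
          linarith
      rw [Real.posLog_eq_log_max_one (norm_nonneg _), Real.posLog_eq_log_max_one (norm_nonneg _)]
      have := Real.log_le_log (by positivity) hup
      rw [Real.log_mul (by positivity) (by positivity), Real.log_pow] at this
      linarith
    · refine le_trans ?_ (le_max_right _ _)
      rcases le_or_gt ‖w.2‖ R with hy | hy
      · refine le_trans ?_ (le_max_left _ _)
        have hwR : ‖w‖ ≤ R := by
          have : ‖w.1‖ ≤ max R ‖w.2‖ := hw
          rw [max_eq_left hy] at this
          exact max_le this hy
        have e1 : Real.posLog ‖w‖ ≤ Real.log R := by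
          rw [Real.posLog_eq_log_max_one (norm_nonneg _)]
          exact Real.log_le_log (by positivity) (max_le hR1 hwR)
        have e2 : 0 ≤ Real.posLog ‖h.toPerm w‖ := Real.posLog_nonneg
        have : (d : ℝ) * Real.posLog ‖w‖ ≤ d * Real.log R := by gcongr
        linarith
      · refine le_trans ?_ (le_max_right _ _)
        have hx : ‖w.1‖ ≤ ‖w.2‖ := by
          have : ‖w.1‖ ≤ max R ‖w.2‖ := hw
          rwa [max_eq_right hy.le] at this
        have hwy : ‖w‖ = ‖w.2‖ := max_eq_right hx
        have hy0 : 0 < ‖w.2‖ := by linarith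
        have hbig : c / 2 * ‖w.2‖ ^ d ≤ ‖h.toPerm w‖ := by
          rw [hval]
          refine le_trans ?_ (le_max_right _ _)
          have h1 := norm_sub_norm_le (h.p.eval w.2) (h.a * w.1)
          rw [norm_mul] at h1
          have h2 := hlow _ hy
          have h3 := hlow' _ hy
          have h4 : ‖h.a‖ * ‖w.1‖ ≤ ‖h.a‖ * ‖w.2‖ := by gcongr
          nlinarith
        have e1 : Real.log (c / 2 * ‖w.2‖ ^ d) ≤ Real.posLog ‖h.toPerm w‖ := by
          rw [Real.posLog_eq_log_max_one (norm_nonneg _)]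
          exact Real.log_le_log (by positivity) (hbig.trans (le_max_right _ _))
        rw [Real.log_mul (by positivity) (by positivity), Real.log_pow] at e1
        rw [hwy, Real.posLog_eq_log (x := ‖w.2‖) (by rw [abs_of_pos hy0]; linarith)]
        linarith
  · have hx : ‖w.1‖ ≤ max R ‖w.2‖ := hw
    have hy : ‖w.2‖ ≤ ‖h.toPerm w‖ := le_max_left _ _
    refine max_le (le_max_left _ _) (max_le (hx.trans (max_le_max le_rfl hy))
      (hy.trans (le_max_right _ _)))

theorem eventually_isFiltered_prod {l : List GeneralizedHenon} (hl : l ≠ []) :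
    ∀ᶠ R : ℝ in atTop, IsFiltered R (l.map GeneralizedHenon.toPerm).prod
      (l.map fun h => h.p.natDegree).prod := by
  induction l with
  | nil => exact absurd rfl hl
  | cons h t ih =>
    rcases eq_or_ne t [] with rfl | ht
    · simpa using h.eventually_isFiltered
    · filter_upwards [h.eventually_isFiltered, ih ht] with R h₁ h₂
      simpa using h₁.mul h₂

/-! ### Holomorphy of the maps and the filtration description of K⁻ -/

theorem IsPolynomialMap.differentiable {F : ℂ × ℂ → ℂ × ℂ} (hF : IsPolynomialMap F) :
    Differentiable ℂ F := by
  obtain ⟨P, Q, hPQ⟩ := hF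
  have key : ∀ P : MvPolynomial (Fin 2) ℂ,
      Differentiable ℂ fun z : ℂ × ℂ => MvPolynomial.eval ![z.1, z.2] P := by
    intro P
    induction P using MvPolynomial.induction_on with
    | C a => simp
    | add p q hp hq => simpa using! hp.fun_add hq
    | mul_X p i hp =>
      have hi : Differentiable ℂ fun z : ℂ × ℂ => ![z.1, z.2] i := by
        fin_cases i
        · exact differentiable_fst
        · exact differentiable_snd
      simpa using! hp.fun_mul hi
  rw [funext hPQ]
  exact (key P).prodMk (key Q)

theorem GeneralizedHenon.differentiable_toPerm (h : GeneralizedHenon) :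
    Differentiable ℂ h.toPerm :=
  differentiable_snd.prodMk
    ((h.p.differentiable.comp differentiable_snd).sub (differentiable_fst.const_mul h.a))

theorem GeneralizedHenon.differentiable_toPerm_symm (h : GeneralizedHenon) :
    Differentiable ℂ h.toPerm.symm := by
  have : Differentiable ℂ fun z : ℂ × ℂ => (h.a⁻¹ * (h.p.eval z.1 - z.2), z.1) :=
    (((h.p.differentiable.comp differentiable_fst).sub differentiable_snd).const_mul
      h.a⁻¹).prodMk differentiable_fst
  convert this using 2 with z
  exact Prod.ext (div_eq_inv_mul _ _) rfl

theorem differentiable_prod_toPerm (l : List GeneralizedHenon) :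
    Differentiable ℂ (l.map GeneralizedHenon.toPerm).prod ∧
      Differentiable ℂ (l.map GeneralizedHenon.toPerm).prod.symm := by
  induction l with
  | nil => exact ⟨differentiable_id, differentiable_id⟩
  | cons h t ih =>
    rw [List.map_cons, List.prod_cons]
    exact ⟨h.differentiable_toPerm.comp ih.1, ih.2.comp h.differentiable_toPerm_symm⟩

theorem Bornology.IsBounded.image_of_continuous {X Y : Type*} [PseudoMetricSpace X] [ProperSpace X]
    [PseudoMetricSpace Y] {s : Set X} (hs : IsBounded s) {g : X → Y} (hg : Continuous g) :
    IsBounded (g '' s) :=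
  (hs.isCompact_closure.image hg).isBounded.subset (Set.image_mono subset_closure)

theorem mem_Kminus {f : Equiv.Perm (ℂ × ℂ)} {z : ℂ × ℂ} :
    z ∈ Kminus f ↔ Bornology.IsBounded (Set.range fun n : ℕ => f.symm^[n] z) := Iff.rfl

namespace HenonCoordinates

variable {f : Equiv.Perm (ℂ × ℂ)} (H : HenonCoordinates f)

/-- The map `f` in Hénon coordinates. -/
noncomputable def normalForm : Equiv.Perm (ℂ × ℂ) := (H.maps.map GeneralizedHenon.toPerm).prod

theorem differentiable_φ : Differentiable ℂ H.φ := H.polynomial_φ.differentiable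

theorem differentiable_φ_symm : Differentiable ℂ H.φ.symm := H.polynomial_φ_symm.differentiable

theorem φ_symm_apply (z : ℂ × ℂ) : H.φ (f.symm z) = H.normalForm.symm (H.φ z) := by
  rw [Equiv.eq_symm_apply, normalForm, ← H.conj, Equiv.apply_symm_apply]

theorem φ_symm_iterate (n : ℕ) (z : ℂ × ℂ) :
    H.φ (f.symm^[n] z) = H.normalForm.symm^[n] (H.φ z) := by
  induction n generalizing z with
  | zero => rfl
  | succ n ih => rw [Function.iterate_succ_apply, Function.iterate_succ_apply, ih, H.φ_symm_apply]

theorem differentiable {f : Equiv.Perm (ℂ × ℂ)} (H : HenonCoordinates f) : Differentiable ℂ f := by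
  have : ⇑f = H.φ.symm ∘ H.normalForm ∘ H.φ := by
    ext1 z
    simp only [Function.comp, Equiv.eq_symm_apply]
    exact H.conj z
  rw [this]
  exact H.differentiable_φ_symm.comp ((differentiable_prod_toPerm _).1.comp H.differentiable_φ)

theorem differentiable_symm {f : Equiv.Perm (ℂ × ℂ)} (H : HenonCoordinates f) :
    Differentiable ℂ f.symm := by
  have : ⇑f.symm = H.φ.symm ∘ H.normalForm.symm ∘ H.φ := by
    ext1 z
    rw [Function.comp, Equiv.eq_symm_apply]
    exact H.φ_symm_apply z
  rw [this]
  exact H.differentiable_φ_symm.comp ((differentiable_prod_toPerm _).2.comp H.differentiable_φ)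

/-- Once a backward orbit leaves the region, its first coordinate at least doubles at each step. If
it never leaves, `max R ‖·‖` cannot increase backwards. -/
theorem mem_Kminus_iff {f : Equiv.Perm (ℂ × ℂ)} {H : HenonCoordinates f} {R : ℝ}
    (hR : IsFiltered R H.normalForm H.degree) (z : ℂ × ℂ) :
    z ∈ Kminus f ↔ ∀ n : ℕ, H.φ (f.symm^[n] z) ∈ forwardRegion R := by
  constructor
  · intro hz n
    by_contra hcon
    set w := H.φ (f.symm^[n] z) with hw
    have hk : ∀ k : ℕ, H.normalForm.symm^[k] w ∉ forwardRegion R ∧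
        2 ^ k * ‖w.1‖ ≤ ‖(H.normalForm.symm^[k] w).1‖ := by
      intro k
      induction k with
      | zero => exact ⟨hcon, by simp⟩
      | succ k ih =>
        rw [Function.iterate_succ_apply']
        obtain ⟨h1, h2⟩ := hR.expands _ ih.1
        refine ⟨h1, ?_⟩
        rw [pow_succ]
        linarith [ih.2]
    have hw0 : 0 < ‖w.1‖ := by
      have : max R ‖w.2‖ < ‖w.1‖ := not_le.1 hcon
      exact (norm_nonneg _).trans_lt ((le_max_right _ _).trans_lt this)
    obtain ⟨B, hB⟩ := isBounded_iff_forall_norm_le.1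
      ((mem_Kminus.1 hz).image_of_continuous H.differentiable_φ.continuous)
    obtain ⟨k, hkB⟩ := pow_unbounded_of_one_lt (B / ‖w.1‖) one_lt_two
    rw [div_lt_iff₀ hw0] at hkB
    have h1 := hB _ ⟨_, ⟨k + n, rfl⟩, rfl⟩
    simp only [Function.iterate_add_apply] at h1
    rw [H.φ_symm_iterate, ← hw] at h1
    linarith [(hk k).2, norm_fst_le (H.normalForm.symm^[k] w)]
  · intro hz
    have hb : ∀ n : ℕ, max R ‖H.φ (f.symm^[n] z)‖ ≤ max R ‖H.φ z‖ := by
      intro n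
      induction n with
      | zero => exact le_rfl
      | succ n ih =>
        refine le_trans ?_ ih
        have := hR.max_le _ (hz (n + 1))
        rwa [Function.iterate_succ_apply', H.φ_symm_apply, Equiv.apply_symm_apply,
          ← H.φ_symm_apply, ← Function.iterate_succ_apply' f.symm n] at this
    refine ((Metric.isBounded_closedBall (x := (0 : ℂ × ℂ))
      (r := max R ‖H.φ z‖)).image_of_continuous H.differentiable_φ_symm.continuous).subset ?_
    rintro _ ⟨n, rfl⟩
    refine ⟨H.φ (f.symm^[n] z), ?_, H.φ.symm_apply_apply _⟩
    rw [mem_closedBall_zero_iff]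
    exact (le_max_right _ _).trans (hb n)

theorem exists_isFiltered : ∃ R : ℝ, IsFiltered R H.normalForm H.degree :=
  (eventually_isFiltered_prod H.maps_ne_nil).exists

theorem isClosed_Kminus {f : Equiv.Perm (ℂ × ℂ)} (H : HenonCoordinates f) : IsClosed (Kminus f) := by
  obtain ⟨R, hR⟩ := H.exists_isFiltered
  have : Kminus f = ⋂ n : ℕ, (fun z => H.φ (f.symm^[n] z)) ⁻¹' forwardRegion R := by
    ext z; rw [mem_Kminus_iff hR]; simp
  rw [this]
  refine isClosed_iInter fun n => IsClosed.preimage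
    (H.differentiable_φ.continuous.comp (H.differentiable_symm.continuous.iterate n)) ?_
  exact isClosed_le continuous_fst.norm (continuous_const.max continuous_snd.norm)

theorem Jminus_subset_Kminus {f : Equiv.Perm (ℂ × ℂ)} (H : HenonCoordinates f) :
    Jminus f ⊆ Kminus f :=
  H.isClosed_Kminus.frontier_subset

end HenonCoordinates

theorem apply_mem_Kminus {f : Equiv.Perm (ℂ × ℂ)} {z : ℂ × ℂ} (hz : z ∈ Kminus f) :
    f z ∈ Kminus f := by
  have : (Set.range fun n : ℕ => f.symm^[n] (f z)) ⊆
      insert (f z) (Set.range fun n : ℕ => f.symm^[n] z) := by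
    rintro _ ⟨_ | n, rfl⟩
    · exact Or.inl rfl
    · right
      exact ⟨n, by simp [Function.iterate_succ_apply]⟩
  exact ((mem_Kminus.1 hz).insert (f z)).subset this

/-! ### The Green function on K⁻ -/

/-- A sequence that is almost multiplied by `d` in each step grows like `dⁿ`. -/
theorem exists_tendsto_div_pow {a : ℕ → ℝ} {d C : ℝ} (hd : 2 ≤ d)
    (ha : ∀ n, |a (n + 1) - d * a n| ≤ C) :
    ∃ l, Tendsto (fun n => (d ^ n)⁻¹ * a n) atTop (𝓝 l) ∧ |l - a 0| ≤ C := by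
  have hd0 : 0 < d := by linarith
  -- As `d ≥ 2`, the increments are dominated by a geometric series with sum exactly `C`.
  have hstep : ∀ n, dist ((d ^ n)⁻¹ * a n) ((d ^ (n + 1))⁻¹ * a (n + 1)) ≤ C / 2 * (1 / 2) ^ n := by
    intro n
    have hC : 0 ≤ C := (abs_nonneg _).trans (ha n)
    have heq : (d ^ n)⁻¹ * a n - (d ^ (n + 1))⁻¹ * a (n + 1) =
        -((d ^ (n + 1))⁻¹ * (a (n + 1) - d * a n)) := by
      rw [pow_succ]; field_simp; ring
    rw [Real.dist_eq, heq, abs_neg, abs_mul, abs_of_pos (by positivity)]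
    have h1 : (d ^ (n + 1))⁻¹ ≤ ((2 : ℝ) ^ (n + 1))⁻¹ := by gcongr
    calc (d ^ (n + 1))⁻¹ * |a (n + 1) - d * a n| ≤ ((2 : ℝ) ^ (n + 1))⁻¹ * C := by
          gcongr; exact ha n
      _ = C / 2 * (1 / 2) ^ n := by rw [pow_succ, one_div, inv_pow]; field_simp
  obtain ⟨l, hl⟩ := cauchySeq_tendsto_of_complete
    (cauchySeq_of_le_geometric (1 / 2 : ℝ) (C / 2) (by norm_num) hstep)
  refine ⟨l, hl, ?_⟩
  have := dist_le_of_le_geometric_of_tendsto₀ (1 / 2 : ℝ) (C / 2) (by norm_num) hstep hl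
  rw [Real.dist_eq, abs_sub_comm] at this
  norm_num at this
  linarith

namespace HenonCoordinates

variable {f : Equiv.Perm (ℂ × ℂ)} (H : HenonCoordinates f)

theorem two_le_degree : 2 ≤ H.degree := H.exists_isFiltered.choose_spec.two_le

theorem exists_posLog_apply_bound : ∃ C : ℝ, ∀ z ∈ Kminus f,
    |Real.posLog ‖H.φ (f z)‖ - H.degree * Real.posLog ‖H.φ z‖| ≤ C := by
  obtain ⟨R, hR⟩ := H.exists_isFiltered
  obtain ⟨C, hC⟩ := hR.growth
  refine ⟨C, fun z hz => ?_⟩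
  rw [H.conj]
  exact hC _ ((mem_Kminus_iff hR z).1 hz 0)

theorem _root_.iterate_mem_Kminus {f : Equiv.Perm (ℂ × ℂ)} {z : ℂ × ℂ} (hz : z ∈ Kminus f)
    (n : ℕ) : f^[n] z ∈ Kminus f := by
  induction n with
  | zero => exact hz
  | succ n ih => rw [Function.iterate_succ_apply']; exact apply_mem_Kminus ih

theorem tendsto_greenPlus {z : ℂ × ℂ} (hz : z ∈ Kminus f) :
    Tendsto (fun n : ℕ => ((H.degree : ℝ) ^ n)⁻¹ * Real.posLog ‖H.φ ((⇑f)^[n] z)‖) atTop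
      (𝓝 (H.greenPlus z)) := by
  obtain ⟨C, hC⟩ := H.exists_posLog_apply_bound
  have hd : (2 : ℝ) ≤ H.degree := by exact_mod_cast H.two_le_degree
  obtain ⟨l, hl, -⟩ := exists_tendsto_div_pow (a := fun n => Real.posLog ‖H.φ ((⇑f)^[n] z)‖) hd
    fun n => by
      simp only [Function.iterate_succ_apply']; exact hC _ (iterate_mem_Kminus hz n)
  exact tendsto_nhds_limUnder ⟨l, hl⟩

/-- The error of one step of `f` is uniform on K⁻, and the telescoping series defining G⁺ sums these
errors with weights `d⁻ⁿ`. -/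
theorem exists_greenPlus_sub_posLog_bound : ∃ C : ℝ, 0 ≤ C ∧ ∀ z ∈ Kminus f,
    |H.greenPlus z - Real.posLog ‖H.φ z‖| ≤ C := by
  obtain ⟨C, hC⟩ := H.exists_posLog_apply_bound
  have hd : (2 : ℝ) ≤ H.degree := by exact_mod_cast H.two_le_degree
  refine ⟨|C|, abs_nonneg C, fun z hz => ?_⟩
  obtain ⟨l, hl, hlC⟩ := exists_tendsto_div_pow
    (a := fun n => Real.posLog ‖H.φ ((⇑f)^[n] z)‖) hd fun n => by
      simp only [Function.iterate_succ_apply']; exact hC _ (iterate_mem_Kminus hz n)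
  rw [tendsto_nhds_unique (H.tendsto_greenPlus hz) hl]
  exact hlC.trans (le_abs_self C)

theorem greenPlus_apply {z : ℂ × ℂ} (hz : z ∈ Kminus f) :
    H.greenPlus (f z) = H.degree * H.greenPlus z := by
  have hd : (H.degree : ℝ) ≠ 0 := by have := H.two_le_degree; positivity
  have h1 := H.tendsto_greenPlus (apply_mem_Kminus hz)
  have h2 := ((tendsto_add_atTop_iff_nat 1).2 (H.tendsto_greenPlus hz)).const_mul (H.degree : ℝ)
  refine tendsto_nhds_unique h1 (h2.congr fun n => ?_)
  rw [Function.iterate_succ_apply, pow_succ]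
  field_simp

theorem greenPlus_iterate {z : ℂ × ℂ} (hz : z ∈ Kminus f) (n : ℕ) :
    H.greenPlus (f^[n] z) = H.degree ^ n * H.greenPlus z := by
  induction n with
  | zero => simp
  | succ n ih =>
    rw [Function.iterate_succ_apply', H.greenPlus_apply (iterate_mem_Kminus hz n), ih, pow_succ]
    ring

theorem greenPlus_nonneg {z : ℂ × ℂ} (hz : z ∈ Kminus f) : 0 ≤ H.greenPlus z :=
  ge_of_tendsto' (H.tendsto_greenPlus hz) fun n => mul_nonneg (by positivity) Real.posLog_nonneg

/-- Sublevel sets of the Green function in `K⁻` are bounded. -/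
theorem isBounded_greenPlus_le (M : ℝ) :
    Bornology.IsBounded {z ∈ Kminus f | H.greenPlus z ≤ M} := by
  obtain ⟨C, -, hC⟩ := H.exists_greenPlus_sub_posLog_bound
  refine ((Metric.isBounded_closedBall (x := (0 : ℂ × ℂ))
    (r := Real.exp (M + C))).image_of_continuous H.differentiable_φ_symm.continuous).subset ?_
  rintro z ⟨hz, hzM⟩
  refine ⟨H.φ z, ?_, H.φ.symm_apply_apply _⟩
  rw [mem_closedBall_zero_iff]
  have h1 := (abs_sub_le_iff.1 (hC z hz)).2
  have h2 : Real.log (max 1 ‖H.φ z‖) ≤ M + C := by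
    rw [← Real.posLog_eq_log_max_one (norm_nonneg _)]; linarith
  exact (le_max_right _ _).trans ((Real.log_le_iff_le_exp (by positivity)).1 h2)

theorem exists_greenPlus_le_of_isBounded {s : Set (ℂ × ℂ)} (hs : Bornology.IsBounded s) :
    ∃ M : ℝ, ∀ z ∈ s, z ∈ Kminus f → H.greenPlus z ≤ M := by
  obtain ⟨C, -, hC⟩ := H.exists_greenPlus_sub_posLog_bound
  obtain ⟨B, hB⟩ := isBounded_iff_forall_norm_le.1
    (hs.image_of_continuous H.differentiable_φ.continuous)
  refine ⟨Real.posLog B + C, fun z hz hzK => ?_⟩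
  have h1 := (abs_sub_le_iff.1 (hC z hzK)).1
  have h2 := Real.posLog_le_posLog (norm_nonneg _) (hB _ ⟨z, hz, rfl⟩)
  linarith

/-- A periodic point lies in K⁻ and satisfies G⁺ = dⁿ G⁺ there, so G⁺ vanishes; the zero set of G⁺
in K⁻ is bounded. -/
theorem isBounded_Jstar {f : Equiv.Perm (ℂ × ℂ)} (H : HenonCoordinates f) :
    Bornology.IsBounded (Jstar f) := by
  refine ((H.isBounded_greenPlus_le 0).subset ?_).closure
  rintro x ⟨n, hn, hx, -⟩
  have hperiodic : Function.IsPeriodicPt f n x := hx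
  have hback : Function.IsPeriodicPt f.symm n x := by
    have := Function.LeftInverse.iterate f.symm_apply_apply n x
    rwa [hx] at this
  have hK : x ∈ Kminus f := by
    refine mem_Kminus.2 (Set.Finite.isBounded ?_)
    refine (Set.finite_range fun k : Fin n => f.symm^[k] x).subset ?_
    rintro _ ⟨k, rfl⟩
    exact ⟨⟨k % n, Nat.mod_lt _ hn⟩, hback.iterate_mod_apply k⟩
  refine ⟨hK, ?_⟩
  have h1 := H.greenPlus_iterate hK n
  rw [hx] at h1
  have hd : (1 : ℝ) < (H.degree : ℝ) ^ n := by
    refine one_lt_pow₀ ?_ (by omega)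
    exact_mod_cast H.two_le_degree
  have h2 := H.greenPlus_nonneg hK
  nlinarith

end HenonCoordinates

/-! ### Montel's theorem, maxima over discs and three circles -/

/-- **Montel's theorem** for sequences of entire maps that are uniformly bounded on each disc. -/
theorem exists_subseq_tendstoLocallyUniformly {E : Type*} [NormedAddCommGroup E] [NormedSpace ℂ E]
    [ProperSpace E] {u : ℕ → ℂ → E} (hu : ∀ n, Differentiable ℂ (u n))
    (hb : ∀ r : ℝ, ∃ B : ℝ, ∀ n, ∀ z : ℂ, ‖z‖ ≤ r → ‖u n z‖ ≤ B) :
    ∃ σ : ℕ → ℕ, StrictMono σ ∧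
      ∃ g : ℂ → E, TendstoLocallyUniformly (fun n => u (σ n)) g atTop := by
  set v : ℕ → C(ℂ, E) := fun n => ⟨u n, (hu n).continuous⟩ with hv
  have heq : Equicontinuous (fun i : Set.range v => (i.1 : ℂ → E)) := by
    intro z₀
    -- Unit circles about points of the unit ball at `z₀` stay in this disc, so Cauchy's estimate
    -- gives a common Lipschitz constant.
    obtain ⟨B, hB⟩ := hb (‖z₀‖ + 2)
    refine Metric.equicontinuousAt_of_continuity_modulus (fun z => B / 1 * ‖z - z₀‖) ?_ _ ?_
    · have : Continuous fun z => B / 1 * ‖z - z₀‖ := by fun_prop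
      simpa using this.tendsto z₀
    · filter_upwards [Metric.ball_mem_nhds z₀ one_pos] with z hz
      rintro ⟨_, n, rfl⟩
      rw [dist_comm, dist_eq_norm]
      refine (convex_ball z₀ (1 : ℝ)).norm_image_sub_le_of_norm_deriv_le
        (fun w _ => hu n w) (fun w hw => ?_) (Metric.mem_ball_self one_pos) hz
      refine Complex.norm_deriv_le_of_forall_mem_sphere_norm_le one_pos (hu n).diffContOnCl
        fun y hy => hB n y ?_
      rw [mem_ball_iff_norm] at hw
      rw [mem_sphere_iff_norm] at hy
      have h1 := norm_add_le (y - w) w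
      have h2 := norm_add_le (w - z₀) z₀
      rw [sub_add_cancel] at h1 h2
      linarith
  have hclosed : IsClosedEmbedding (UniformOnFun.ofFun {K : Set ℂ | IsCompact K} ∘
      (fun c : C(ℂ, E) => (c : ℂ → E))) := by
    refine ⟨ContinuousMap.isUniformEmbedding_toUniformOnFunIsCompact.isEmbedding, ?_⟩
    change IsClosed (Set.range ContinuousMap.toUniformOnFunIsCompact)
    rw [ContinuousMap.range_toUniformOnFunIsCompact]
    exact UniformOnFun.isClosed_setOfPred_continuous CompactlyCoherentSpace.isCoherentWith
  have hcomp : IsCompact (closure (Set.range v)) := by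
    refine ArzelaAscoli.isCompact_closure_of_isClosedEmbedding (fun K hK => hK) hclosed
      (fun K _ => heq.equicontinuousOn K) fun K _ z _ => ?_
    obtain ⟨B, hB⟩ := hb ‖z‖
    refine ⟨Metric.closedBall 0 B, isCompact_closedBall _ _, ?_⟩
    rintro _ ⟨n, rfl⟩
    simpa using! hB n z le_rfl
  obtain ⟨g, -, σ, hσ, hlim⟩ := hcomp.tendsto_subseq fun n => subset_closure ⟨n, rfl⟩
  exact ⟨σ, hσ, g, ContinuousMap.tendsto_iff_tendstoLocallyUniformly.1 hlim⟩

/-- Adjoining a constant coordinate 1 realizes log⁺ as the logarithm of the norm of a holomorphic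
map, to which the three lines theorem applies. -/
theorem norm_one_prodMk (w : ℂ × ℂ) : ‖((1 : ℂ), w)‖ = Real.exp (Real.posLog ‖w‖) := by
  rw [Real.posLog_eq_log_max_one (norm_nonneg _), Real.exp_log (by positivity), Prod.norm_mk,
    norm_one]

theorem discMax_le {G : ℂ × ℂ → ℝ} {ψ : ℂ → ℂ × ℂ} {r M : ℝ} (hr : 0 ≤ r)
    (h : ∀ ζ, ‖ζ‖ ≤ r → G (ψ ζ) ≤ M) : discMax G ψ r ≤ M := by
  refine csSup_le ((Metric.nonempty_closedBall.2 hr).image _) ?_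
  rintro _ ⟨ζ, hζ, rfl⟩
  exact h ζ (by simpa using hζ)

namespace HenonCoordinates

variable {f : Equiv.Perm (ℂ × ℂ)} (H : HenonCoordinates f)

theorem greenPlus_le_discMax {ψ : ℂ → ℂ × ℂ} (hψ : Differentiable ℂ ψ)
    (hK : ∀ ζ, ψ ζ ∈ Kminus f) {r : ℝ} {ζ : ℂ} (hζ : ‖ζ‖ ≤ r) :
    H.greenPlus (ψ ζ) ≤ discMax H.greenPlus ψ r := by
  refine le_csSup ?_ ⟨ζ, by simpa using hζ, rfl⟩
  obtain ⟨M, hM⟩ := H.exists_greenPlus_le_of_isBounded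
    ((isCompact_closedBall (0 : ℂ) r).image hψ.continuous).isBounded
  refine ⟨M, ?_⟩
  rintro _ ⟨z, hz, rfl⟩
  exact hM _ ⟨z, hz, rfl⟩ (hK z)

theorem discMax_mono {ψ : ℂ → ℂ × ℂ} (hψ : Differentiable ℂ ψ)
    (hK : ∀ ζ, ψ ζ ∈ Kminus f) {r s : ℝ} (hr : 0 ≤ r) (hrs : r ≤ s) :
    discMax H.greenPlus ψ r ≤ discMax H.greenPlus ψ s :=
  discMax_le hr fun _ hζ => H.greenPlus_le_discMax hψ hK (hζ.trans hrs)

theorem discMax_mul {ψ₁ ψ₂ : ℂ → ℂ × ℂ} (hψ₁ : Differentiable ℂ ψ₁) (hK₁ : ∀ ζ, ψ₁ ζ ∈ Kminus f)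
    (hψ₂ : Differentiable ℂ ψ₂) (hK₂ : ∀ ζ, ψ₂ ζ ∈ Kminus f) {l : ℂ} (hl0 : l ≠ 0)
    (hl : ∀ ζ, f (ψ₁ ζ) = ψ₂ (l * ζ)) {r : ℝ} (hr : 0 ≤ r) :
    discMax H.greenPlus ψ₂ (‖l‖ * r) = H.degree * discMax H.greenPlus ψ₁ r := by
  have hl' : 0 < ‖l‖ := norm_pos_iff.2 hl0
  have hd : (0 : ℝ) < H.degree := by have := H.two_le_degree; positivity
  refine le_antisymm (discMax_le (by positivity) fun ζ hζ => ?_) ?_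
  · have h1 : ‖ζ / l‖ ≤ r := by rw [norm_div, div_le_iff₀ hl']; linarith
    have h2 := H.greenPlus_le_discMax hψ₁ hK₁ h1
    have h3 := H.greenPlus_apply (hK₁ (ζ / l))
    rw [hl, mul_div_cancel₀ _ hl0] at h3
    rw [h3]
    gcongr
  · rw [← le_div_iff₀' hd]
    refine discMax_le hr fun ζ hζ => ?_
    rw [le_div_iff₀' hd, ← H.greenPlus_apply (hK₁ ζ), hl]
    refine H.greenPlus_le_discMax hψ₂ hK₂ ?_
    rw [norm_mul]
    gcongr

theorem differentiable_φ_iterate (n : ℕ) : Differentiable ℂ fun z => H.φ (f^[n] z) := by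
  refine H.differentiable_φ.comp ?_
  induction n with
  | zero => exact differentiable_id
  | succ n ih => rw [Function.iterate_succ]; exact ih.comp H.differentiable

/-- The three circles theorem for `G⁺ ∘ ψ`. -/
theorem greenPlus_three_circles {ψ : ℂ → ℂ × ℂ} (hψ : Differentiable ℂ ψ)
    (hK : ∀ ζ, ψ ζ ∈ Kminus f) {r A B : ℝ} (hr : 1 < r)
    (hA : ∀ ζ, ‖ζ‖ = 1 → H.greenPlus (ψ ζ) ≤ A) (hB : ∀ ζ, ‖ζ‖ ≤ r → H.greenPlus (ψ ζ) ≤ B)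
    {ζ : ℂ} (h1 : 1 ≤ ‖ζ‖) (h2 : ‖ζ‖ ≤ r) :
    H.greenPlus (ψ ζ) ≤
      (1 - Real.log ‖ζ‖ / Real.log r) * A + Real.log ‖ζ‖ / Real.log r * B := by
  obtain ⟨C, hC0, hC⟩ := H.exists_greenPlus_sub_posLog_bound
  have hlr : 0 < Real.log r := Real.log_pos hr
  have hd : (1 : ℝ) < H.degree := by exact_mod_cast H.two_le_degree
  set t := Real.log ‖ζ‖ / Real.log r with ht
  have ht0 : 0 ≤ t := div_nonneg (Real.log_nonneg h1) hlr.le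
  have ht1 : t ≤ 1 := (div_le_one hlr).2 (Real.log_le_log (by linarith) h2)
  -- Replacing dⁿ G⁺ by log⁺‖φ ∘ fⁿ‖ costs at most `C` on each side; since `n` is arbitrary, the
  -- bounded total error disappears after division by dⁿ.
  have key : ∀ n : ℕ, (H.degree : ℝ) ^ n * (H.greenPlus (ψ ζ) - ((1 - t) * A + t * B)) ≤ 2 * C := by
    intro n
    set D : ℝ := (H.degree : ℝ) ^ n with hD
    have hD0 : 0 < D := by positivity
    have hcmp : ∀ ξ, |D * H.greenPlus (ψ ξ) - Real.posLog ‖H.φ (f^[n] (ψ ξ))‖| ≤ C := fun ξ => by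
      rw [hD, ← H.greenPlus_iterate (hK ξ)]
      exact hC _ (iterate_mem_Kminus (hK ξ) n)
    -- The exponential carries the strip `0 ≤ re w ≤ 1` onto the annulus between radii 1 and `r`.
    set Φ : ℂ → ℂ × (ℂ × ℂ) :=
      fun w => (1, H.φ (f^[n] (ψ (Complex.exp (w * Real.log r))))) with hΦ
    have hΦd : Differentiable ℂ Φ := by
      refine (differentiable_const _).prodMk ((H.differentiable_φ_iterate n).comp (hψ.comp ?_))
      fun_prop
    have hnorm : ∀ w : ℂ, ‖Complex.exp (w * Real.log r)‖ = r ^ w.re := by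
      intro w
      rw [Complex.norm_exp, Complex.re_mul_ofReal, Real.rpow_def_of_pos (by linarith), mul_comm]
    have hbound : ∀ w M, H.greenPlus (ψ (Complex.exp (w * Real.log r))) ≤ M →
        ‖Φ w‖ ≤ Real.exp (D * M + C) := by
      intro w M hM
      rw [hΦ, norm_one_prodMk, Real.exp_le_exp]
      have := (abs_sub_le_iff.1 (hcmp (Complex.exp (w * Real.log r)))).2
      have : D * H.greenPlus (ψ (Complex.exp (w * Real.log r))) ≤ D * M := by gcongr
      linarith
    have hle : ∀ w : ℂ, w.re ≤ 1 → ‖Complex.exp (w * Real.log r)‖ ≤ r := fun w hw => by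
      rw [hnorm]; exact (Real.rpow_le_rpow_of_exponent_le hr.le hw).trans_eq (Real.rpow_one r)
    set w₀ : ℂ := Complex.log ζ / Real.log r with hw₀
    have hζ0 : ζ ≠ 0 := norm_pos_iff.1 (by linarith)
    have hexp : Complex.exp (w₀ * Real.log r) = ζ := by
      rw [hw₀, div_mul_cancel₀ _ (by exact_mod_cast hlr.ne'), Complex.exp_log hζ0]
    have hre : w₀.re = t := by rw [hw₀, Complex.div_ofReal_re, Complex.log_re]
    have h3 := Complex.HadamardThreeLines.norm_le_interp_of_mem_verticalClosedStrip₀₁' Φ (z := w₀)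
      (a := Real.exp (D * A + C)) (b := Real.exp (D * B + C))
      (by
        rw [Complex.HadamardThreeLines.verticalClosedStrip, Set.mem_preimage, hre]
        exact ⟨ht0, ht1⟩)
      hΦd.diffContOnCl
      ⟨Real.exp (D * B + C), by
        rintro _ ⟨w, hw, rfl⟩
        exact hbound w B (hB _ (hle w hw.2))⟩
      (fun w hw => hbound w A (hA _ (by rw [hnorm, show w.re = 0 from hw, Real.rpow_zero])))
      (fun w hw => hbound w B (hB _ (hle w (le_of_eq hw))))
    rw [hΦ, norm_one_prodMk, hexp, hre, ← Real.exp_mul, ← Real.exp_mul, ← Real.exp_add,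
      Real.exp_le_exp] at h3
    have h4 := (abs_sub_le_iff.1 (hcmp ζ)).1
    linarith
  by_contra! hcon
  obtain ⟨n, hn⟩ := pow_unbounded_of_one_lt
    (2 * C / (H.greenPlus (ψ ζ) - ((1 - t) * A + t * B))) hd
  rw [div_lt_iff₀ (by linarith)] at hn
  linarith [key n]

end HenonCoordinates

/-! ### Normalized families: multipliers and growth -/

theorem Equiv.Perm.injectiveImmersion_comp {f : Equiv.Perm (ℂ × ℂ)} (hf : Differentiable ℂ f)
    (hf' : Differentiable ℂ f.symm) {ψ : ℂ → ℂ × ℂ} (hψ : IsInjectiveImmersion ψ) :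
    IsInjectiveImmersion fun ζ => f (ψ ζ) where
  differentiable := hf.comp hψ.differentiable
  injective := f.injective.comp hψ.injective
  deriv_ne_zero ζ h0 := by
    refine hψ.deriv_ne_zero ζ ?_
    have h1 : HasDerivAt (fun ζ => f (ψ ζ)) 0 ζ := h0 ▸ (hf.comp hψ.differentiable ζ).hasDerivAt
    have h2 := (hf' (f (ψ ζ))).hasFDerivAt.comp_hasDerivAt ζ h1
    simpa [Function.comp_def] using! h2.deriv

namespace IsNormalizedFamily

variable {f : Equiv.Perm (ℂ × ℂ)} {H : HenonCoordinates f} {S : Set (ℂ × ℂ)}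
  {ψ : ℂ × ℂ → ℂ → ℂ × ℂ}

theorem apply_mem (hψ : IsNormalizedFamily f H.greenPlus S ψ) {x : ℂ × ℂ} (hx : x ∈ S) :
    f x ∈ S :=
  hψ.invariant.subset ⟨x, hx, rfl⟩

theorem differentiable (hψ : IsNormalizedFamily f H.greenPlus S ψ) {x : ℂ × ℂ} (hx : x ∈ S) :
    Differentiable ℂ (ψ x) :=
  (hψ.immersion x hx).differentiable

theorem mem_Kminus (hψ : IsNormalizedFamily f H.greenPlus S ψ) {x : ℂ × ℂ} (hx : x ∈ S) (ζ : ℂ) :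
    ψ x ζ ∈ Kminus f :=
  H.Jminus_subset_Kminus (hψ.range_subset x hx ⟨ζ, rfl⟩)

theorem existsUnique_isMultiplier (hψ : IsNormalizedFamily f H.greenPlus S ψ) {x : ℂ × ℂ}
    (hx : x ∈ S) : ∃! l : ℂ, IsMultiplier f ψ x l := by
  refine existsUnique_eq_comp_mul (g := fun ζ => f (ψ x ζ))
    (Equiv.Perm.injectiveImmersion_comp H.differentiable H.differentiable_symm
      (hψ.immersion x hx)) (hψ.immersion _ (hψ.apply_mem hx)) ?_ ?_
  · rw [← hψ.image_range x hx, ← Set.range_comp]; rfl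
  · simp only [hψ.map_zero x hx, hψ.map_zero _ (hψ.apply_mem hx)]

theorem multiplier_ne_zero (hψ : IsNormalizedFamily f H.greenPlus S ψ) {x : ℂ × ℂ}
    (hx : x ∈ S) {l : ℂ} (hl : IsMultiplier f ψ x l) : l ≠ 0 := by
  rintro rfl
  have h : f (ψ x 0) = f (ψ x 1) := by rw [hl, hl, zero_mul, zero_mul]
  exact zero_ne_one ((hψ.immersion x hx).injective (f.injective h))

theorem discMax_apply (hψ : IsNormalizedFamily f H.greenPlus S ψ) {x : ℂ × ℂ}
    (hx : x ∈ S) {l : ℂ} (hl : IsMultiplier f ψ x l) {r : ℝ} (hr : 0 ≤ r) :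
    discMax H.greenPlus (ψ (f x)) (‖l‖ * r) = H.degree * discMax H.greenPlus (ψ x) r :=
  have hfx := hψ.apply_mem hx
  H.discMax_mul (hψ.differentiable hx) (hψ.mem_Kminus hx) (hψ.differentiable hfx)
    (hψ.mem_Kminus hfx) (hψ.multiplier_ne_zero hx hl) hl hr

/-- Uniform growth control on some disc larger than the unit disc bounds the multipliers. -/
theorem exists_one_lt_le_norm_multiplier (hψ : IsNormalizedFamily f H.greenPlus S ψ) {r M : ℝ}
    (hr : 1 < r) (hM : ∀ x ∈ S, discMax H.greenPlus (ψ x) r ≤ M) :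
    ∃ κ : ℝ, 1 < κ ∧ ∀ x ∈ S, ∀ l, IsMultiplier f ψ x l → κ ≤ ‖l‖ := by
  have hlr : 0 < Real.log r := Real.log_pos hr
  have hd : (2 : ℝ) ≤ H.degree := by exact_mod_cast H.two_le_degree
  set M' := max M 2 with hM'
  have hM'0 : 2 ≤ M' := le_max_right _ _
  -- Below this value the three circles bound at radius `‖l‖` is less than 2, whereas the
  -- normalization forces the value d ≥ 2.
  refine ⟨min r (Real.exp (Real.log r / M')), lt_min hr (Real.one_lt_exp_iff.2 (by positivity)),
    fun x hx l hl => ?_⟩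
  have hfx := hψ.apply_mem hx
  have hval : discMax H.greenPlus (ψ (f x)) ‖l‖ = H.degree := by
    have := hψ.discMax_apply hx hl zero_le_one
    rwa [mul_one, hψ.discMax_one x hx, mul_one] at this
  by_contra! hcon
  obtain ⟨hlr', hle⟩ := lt_min_iff.1 hcon
  have hl0 : 0 < ‖l‖ := norm_pos_iff.2 (hψ.multiplier_ne_zero hx hl)
  have hlog : Real.log ‖l‖ < Real.log r / M' := (Real.log_lt_iff_lt_exp hl0).2 hle
  have hone : ∀ ζ, ‖ζ‖ ≤ 1 → H.greenPlus (ψ (f x) ζ) ≤ 1 := fun ζ hζ =>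
    (H.greenPlus_le_discMax (hψ.differentiable hfx) (hψ.mem_Kminus hfx) hζ).trans_eq
      (hψ.discMax_one _ hfx)
  -- The maximum with 0 covers `‖l‖ < 1`, which is not excluded at this point.
  have hupper : discMax H.greenPlus (ψ (f x)) ‖l‖ ≤ 1 + max 0 (Real.log ‖l‖ / Real.log r) * M' := by
    refine discMax_le hl0.le fun ζ hζ => ?_
    rcases le_total ‖ζ‖ 1 with h1 | h1
    · have := hone ζ h1
      have : 0 ≤ max 0 (Real.log ‖l‖ / Real.log r) * M' := by positivity
      linarith
    · have h3 := H.greenPlus_three_circles (hψ.differentiable hfx) (hψ.mem_Kminus hfx) hr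
        (fun ζ hζ => hone ζ hζ.le)
        (fun ζ hζ => (H.greenPlus_le_discMax (hψ.differentiable hfx) (hψ.mem_Kminus hfx) hζ).trans
          ((hM _ hfx).trans (le_max_left M 2))) h1 (hζ.trans hlr'.le)
      have h4 : Real.log ‖ζ‖ / Real.log r ≤ max 0 (Real.log ‖l‖ / Real.log r) :=
        le_trans (by gcongr) (le_max_right _ _)
      have h5 : 0 ≤ Real.log ‖ζ‖ / Real.log r := div_nonneg (Real.log_nonneg h1) hlr.le
      have h6 : Real.log ‖ζ‖ / Real.log r * M' ≤ max 0 (Real.log ‖l‖ / Real.log r) * M' := by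
        gcongr
      linarith
  have hlt : max 0 (Real.log ‖l‖ / Real.log r) * M' < 1 := by
    rw [← lt_div_iff₀ (by positivity)]
    refine max_lt (by positivity) ?_
    rw [div_lt_iff₀ hlr]
    rwa [div_eq_inv_mul, ← one_div] at hlog
  linarith

section Expanding

variable {κ : ℝ}

/-- Pull back by `f`, using `f '' S = S`: the disc of radius `κ ^ (n + 1)` lies in the image, under
multiplication by `l`, of the disc of radius `κ ^ n`. -/
theorem discMax_pow_le (hψ : IsNormalizedFamily f H.greenPlus S ψ) (hκ : 1 < κ)
    (hexp : ∀ x ∈ S, ∃ l : ℂ, IsMultiplier f ψ x l ∧ κ ≤ ‖l‖) (n : ℕ) :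
    ∀ x ∈ S, discMax H.greenPlus (ψ x) (κ ^ n) ≤ (H.degree : ℝ) ^ n := by
  induction n with
  | zero => intro x hx; simpa using (hψ.discMax_one x hx).le
  | succ n ih =>
    intro y hy
    obtain ⟨x, hx, rfl⟩ := hψ.invariant.superset hy
    obtain ⟨l, hl, hκl⟩ := hexp x hx
    have h0 : 0 ≤ κ ^ n := by positivity
    calc discMax H.greenPlus (ψ (f x)) (κ ^ (n + 1))
        ≤ discMax H.greenPlus (ψ (f x)) (‖l‖ * κ ^ n) :=
          H.discMax_mono (hψ.differentiable hy) (hψ.mem_Kminus hy) (by positivity)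
            (by rw [pow_succ']; gcongr)
      _ = H.degree * discMax H.greenPlus (ψ x) (κ ^ n) := hψ.discMax_apply hx hl h0
      _ ≤ H.degree * (H.degree : ℝ) ^ n := by gcongr; exact ih x hx
      _ = (H.degree : ℝ) ^ (n + 1) := (pow_succ' _ _).symm

/-- Push forward by `f` until the disc has grown to radius at least 1, where the normalization
applies; each step costs a factor d. -/
theorem one_le_pow_mul_discMax (hψ : IsNormalizedFamily f H.greenPlus S ψ)
    (hexp : ∀ x ∈ S, ∃ l : ℂ, IsMultiplier f ψ x l ∧ κ ≤ ‖l‖) (hκ : 1 < κ) (n : ℕ) :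
    ∀ r : ℝ, 0 ≤ r → 1 ≤ κ ^ n * r → ∀ x ∈ S,
      1 ≤ (H.degree : ℝ) ^ n * discMax H.greenPlus (ψ x) r := by
  induction n with
  | zero =>
    intro r _ h1 x hx
    rw [pow_zero, one_mul] at h1 ⊢
    rw [← hψ.discMax_one x hx]
    exact H.discMax_mono (hψ.differentiable hx) (hψ.mem_Kminus hx) zero_le_one h1
  | succ n ih =>
    intro r hr h1 x hx
    obtain ⟨l, hl, hκl⟩ := hexp x hx
    have h2 := ih (‖l‖ * r) (by positivity) (h1.trans (by
      rw [pow_succ, mul_assoc]; gcongr)) _ (hψ.apply_mem hx)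
    rwa [hψ.discMax_apply hx hl hr, ← mul_assoc, ← pow_succ] at h2

theorem exists_discMax_le_rpow (hψ : IsNormalizedFamily f H.greenPlus S ψ) (hκ : 1 < κ)
    (hexp : ∀ x ∈ S, ∃ l : ℂ, IsMultiplier f ψ x l ∧ κ ≤ ‖l‖) :
    ∃ C β : ℝ, ∀ x ∈ S, ∀ r : ℝ, 1 ≤ r → discMax H.greenPlus (ψ x) r ≤ C * r ^ β := by
  have hd : (1 : ℝ) < H.degree := by exact_mod_cast H.two_le_degree
  have hd0 : (0 : ℝ) < H.degree := by linarith
  have hlκ : 0 < Real.log κ := Real.log_pos hκ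
  -- This exponent satisfies `κ ^ β = d`, so the bounds at the radii `κ ^ n` interpolate to a power
  -- law.
  set β := Real.log H.degree / Real.log κ with hβ
  have hβ0 : 0 ≤ β := div_nonneg (Real.log_pos hd).le hlκ.le
  have hκβ : κ ^ β = H.degree := by
    rw [Real.rpow_def_of_pos (by linarith), hβ, mul_div_cancel₀ _ hlκ.ne', Real.exp_log hd0]
  refine ⟨H.degree, β, fun x hx r hr => ?_⟩
  obtain ⟨n, hn, hn'⟩ := exists_nat_pow_near hr hκ
  have hpow : (H.degree : ℝ) ^ n ≤ r ^ β := by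
    rw [← hκβ, ← Real.rpow_mul_natCast (by linarith), mul_comm, Real.rpow_natCast_mul (by linarith)]
    gcongr
  calc discMax H.greenPlus (ψ x) r ≤ discMax H.greenPlus (ψ x) (κ ^ (n + 1)) :=
        H.discMax_mono (hψ.differentiable hx) (hψ.mem_Kminus hx) (by linarith) hn'.le
    _ ≤ (H.degree : ℝ) ^ (n + 1) := hψ.discMax_pow_le hκ hexp _ x hx
    _ = H.degree * (H.degree : ℝ) ^ n := pow_succ' _ _
    _ ≤ H.degree * r ^ β := by gcongr

end Expanding

theorem isNormalFamily (hψ : IsNormalizedFamily f H.greenPlus S ψ)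
    (hb : ∀ r : ℝ, ∃ M : ℝ, ∀ x ∈ S, ∀ ζ : ℂ, ‖ζ‖ ≤ r → H.greenPlus (ψ x ζ) ≤ M) :
    IsNormalFamily (ψ '' S) := by
  intro u hu
  choose x hx hxu using hu
  obtain ⟨σ, hσ, hg⟩ := exists_subseq_tendstoLocallyUniformly (u := u)
    (fun n => hxu n ▸ hψ.differentiable (hx n)) fun r => by
      obtain ⟨M, hM⟩ := hb r
      obtain ⟨B, hB⟩ := isBounded_iff_forall_norm_le.1 (H.isBounded_greenPlus_le M)
      refine ⟨B, fun n z hz => hB _ ⟨?_, ?_⟩⟩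
      · rw [← hxu n]; exact hψ.mem_Kminus (hx n) z
      · rw [← hxu n]; exact hM _ (hx n) z hz
  exact ⟨σ, hσ, Or.inl hg⟩

/-- Along curves with unbounded maxima, a convergent subsequence would keep the disc in a bounded
set, where G⁺ is bounded on K⁻; divergence contradicts the boundedness of J* at `ζ = 0`. -/
theorem exists_discMax_le_of_isNormalFamily (hψ : IsNormalizedFamily f H.greenPlus S ψ)
    (hN : IsNormalFamily (ψ '' S)) {r : ℝ} (hr : 0 ≤ r) :
    ∃ M : ℝ, ∀ x ∈ S, discMax H.greenPlus (ψ x) r ≤ M := by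
  by_contra! hcon
  choose x hx hxM using fun n : ℕ => hcon n
  obtain ⟨σ, hσ, ⟨g, hg⟩ | hinf⟩ := hN (fun n => ψ (x n)) fun n => ⟨x n, hx n, rfl⟩
  · have hgc : Continuous g := hg.continuous <| Eventually.frequently <|
      Eventually.of_forall fun n => (hψ.differentiable (hx (σ n))).continuous
    obtain ⟨B, hB⟩ := (isCompact_closedBall (0 : ℂ) r).exists_bound_of_continuousOn hgc.continuousOn
    have hunif := (tendstoLocallyUniformlyOn_iff_tendstoUniformlyOn_of_compact
      (isCompact_closedBall (0 : ℂ) r)).1 (hg.tendstoLocallyUniformlyOn)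
    obtain ⟨M, hM⟩ := H.exists_greenPlus_le_of_isBounded
      (Metric.isBounded_closedBall (x := (0 : ℂ × ℂ)) (r := B + 1))
    obtain ⟨n, hn, hnM⟩ := ((Metric.tendstoUniformlyOn_iff.1 hunif 1 one_pos).and
      (eventually_ge_atTop ⌈M⌉₊)).exists
    refine (hxM (σ n)).not_ge (le_trans (discMax_le hr fun ζ hζ => ?_)
      ((Nat.le_ceil M).trans (Nat.cast_le.2 (hnM.trans (hσ.id_le n)))))
    refine hM _ ?_ (hψ.mem_Kminus (hx (σ n)) ζ)
    have hζ' : ζ ∈ Metric.closedBall (0 : ℂ) r := by simpa using hζ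
    have h1 := hn ζ hζ'
    have h2 := hB ζ hζ'
    rw [dist_comm, dist_eq_norm] at h1
    rw [mem_closedBall_zero_iff]
    have h3 := norm_add_le (ψ (x (σ n)) ζ - g ζ) (g ζ)
    rw [sub_add_cancel] at h3
    linarith
  · obtain ⟨B, hB⟩ := isBounded_iff_forall_norm_le.1 H.isBounded_Jstar
    obtain ⟨n, hn⟩ := (hinf {0} isCompact_singleton (B + 1)).exists
    have h1 := hn 0 rfl
    simp only [hψ.map_zero _ (hx (σ n))] at h1
    linarith [hB _ (hψ.subset_Jstar (hx (σ n)))]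

end IsNormalizedFamily

/-! ### The equivalences -/

theorem familySup_lt_top_iff {G : ℂ × ℂ → ℝ} {S : Set (ℂ × ℂ)} {ψ : ℂ × ℂ → ℂ → ℂ × ℂ} {r : ℝ} :
    familySup G S ψ r < ⊤ ↔ ∃ M : ℝ, ∀ x ∈ S, discMax G (ψ x) r ≤ M := by
  constructor
  · intro h
    refine ⟨(familySup G S ψ r).toReal, fun x hx => ?_⟩
    rw [← ENNReal.ofReal_le_iff_le_toReal h.ne]
    exact le_iSup₂ (f := fun x (_ : x ∈ S) => ENNReal.ofReal (discMax G (ψ x) r)) x hx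
  · rintro ⟨M, hM⟩
    exact (iSup₂_le fun x hx => ENNReal.ofReal_le_ofReal (hM x hx)).trans_lt
      (ENNReal.ofReal_lt_top (r := M))

theorem theorem1p2 (f : Equiv.Perm (ℂ × ℂ)) (H : HenonCoordinates f)
    (S : Set (ℂ × ℂ)) (ψ : ℂ × ℂ → ℂ → ℂ × ℂ)
    (hψ : IsNormalizedFamily f H.greenPlus S ψ) :
    (∀ x ∈ S, ∃! l : ℂ, IsMultiplier f ψ x l) ∧
    List.TFAE [
      IsNormalFamily (ψ '' S),
      ∃ r₀ : ℝ, 1 < r₀ ∧ familySup H.greenPlus S ψ r₀ < ⊤,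
      ∀ r₁ r₂ : ℝ, 0 < r₁ → r₁ < r₂ → ∃ k : ℝ, ∀ x ∈ S,
        0 < discMax H.greenPlus (ψ x) r₁ ∧
          discMax H.greenPlus (ψ x) r₂ / discMax H.greenPlus (ψ x) r₁ ≤ k,
      ∃ κ : ℝ, 1 < κ ∧ ∀ x ∈ S, ∃ l : ℂ, IsMultiplier f ψ x l ∧ κ ≤ ‖l‖,
      ∃ C β : ℝ, ∀ x ∈ S, ∀ r : ℝ, 1 ≤ r →
        discMax H.greenPlus (ψ x) r ≤ C * r ^ β] := by
  refine ⟨fun x hx => hψ.existsUnique_isMultiplier hx, ?_⟩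
  tfae_have 1 → 2 := fun hN =>
    ⟨2, one_lt_two, familySup_lt_top_iff.2
      (hψ.exists_discMax_le_of_isNormalFamily hN zero_le_two)⟩
  tfae_have 2 → 4 := by
    rintro ⟨r, hr, hM⟩
    obtain ⟨M, hM⟩ := familySup_lt_top_iff.1 hM
    obtain ⟨κ, hκ, hle⟩ := hψ.exists_one_lt_le_norm_multiplier hr hM
    refine ⟨κ, hκ, fun x hx => ?_⟩
    obtain ⟨l, hl, -⟩ := hψ.existsUnique_isMultiplier hx
    exact ⟨l, hl, hle x hx l hl⟩
  tfae_have 4 → 5 := fun ⟨_, hκ, hexp⟩ => hψ.exists_discMax_le_rpow hκ hexp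
  tfae_have 5 → 1 := by
    rintro ⟨C, β, h⟩
    refine hψ.isNormalFamily fun r => ⟨C * max r 1 ^ β, fun x hx ζ hζ => ?_⟩
    exact (H.greenPlus_le_discMax (hψ.differentiable hx) (hψ.mem_Kminus hx)
      (hζ.trans (le_max_left r 1))).trans (h x hx _ (le_max_right r 1))
  tfae_have 3 → 2 := by
    intro h
    obtain ⟨k, hk⟩ := h 1 2 one_pos one_lt_two
    refine ⟨2, one_lt_two, familySup_lt_top_iff.2 ⟨k, fun x hx => ?_⟩⟩
    simpa [hψ.discMax_one x hx] using (hk x hx).2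
  tfae_have 4 → 3 := by
    rintro ⟨κ, hκ, hexp⟩ r₁ r₂ h₁ h₂
    have hd : (0 : ℝ) < H.degree := by have := H.two_le_degree; positivity
    -- Here `n` steps enlarge radius `r₁` beyond 1, and `κ ^ N` exceeds `r₂`; the ratio is then at
    -- most `d ^ (N + n)`.
    obtain ⟨n, hn⟩ := pow_unbounded_of_one_lt r₁⁻¹ hκ
    obtain ⟨N, hN⟩ := pow_unbounded_of_one_lt r₂ hκ
    refine ⟨(H.degree : ℝ) ^ N * (H.degree : ℝ) ^ n, fun x hx => ?_⟩
    have hlow := hψ.one_le_pow_mul_discMax hexp hκ n r₁ h₁.le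
      ((inv_le_iff_one_le_mul₀ h₁).1 hn.le) x hx
    have hpos : 0 < discMax H.greenPlus (ψ x) r₁ :=
      pos_of_mul_pos_right (one_pos.trans_le hlow) (by positivity)
    refine ⟨hpos, ?_⟩
    rw [div_le_iff₀ hpos, mul_assoc]
    have hup : discMax H.greenPlus (ψ x) r₂ ≤ (H.degree : ℝ) ^ N :=
      (H.discMax_mono (hψ.differentiable hx) (hψ.mem_Kminus hx) (by linarith) hN.le).trans
        (hψ.discMax_pow_le hκ hexp N x hx)
    exact hup.trans (le_mul_of_one_le_right (by positivity) hlow)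
  tfae_finish
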